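/- **Setting.** Let $Y\subseteq\mathbb R^{d'}$ be nonempty, closed and convex, $f:\mathbb R^d\times Y\to\mathbb R$ differentiable in each variable, $P(x)=\max_{y\in Y}f(x,y)$, and for a function $h$ put $\mathrm{Gap}_h(x,y)=\max_{y'\in Y}h(x,y')-\min_{x'\in\mathbb R^d}h(x',y)$. Assume: 1. $F=(\nabla_xf,-\nabla_yf)$ is $\ell$-Lipschitz on $\mathbb R^d\times Y$; $f(x,\cdot)$ is $\mu_y$-strongly concave on $Y$ for every $x$ ($\mu_y>0$); $P$ is differentiable with $L$-Lipschitz gradient and has a minimizer $x_*$; and $\mathrm{Gap}_f(x_0,y_0)\le\epsilon_0<\infty$ for the starting point $(x_0,y_0)\in\mathbb R^d\times Y$, $\epsilon_0>0$. 2. $P$ satisfies the $\mu$-PL condition $\|\nabla P(x)\|^2\ge2\mu(P(x)-P(x_*))$ for all $x$ ($\mu>0$). 3. $f(\cdot,y)$ is $\rho$-weakly convex for every $y\in Y$, i.e. $\langle\nabla_xf(x',y),x-x'\rangle-\frac\rho2\|x-x'\|^2\le f(x,y)-f(x',y)$, where $0<\rho\le\ell$ and $\rho\le\mu/8$. 4.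 A stochastic oracle returns unbiased estimates $\mathcal G_x(x,y;\xi)$, $\mathcal G_y(x,y;\xi)$ of $\nabla_xf(x,y)$, $\nabla_yf(x,y)$, $\xi\sim\nu$, and for some $B>0$ we have $\mathbb E_\xi\|\mathcal G_x(z;\xi)\|^2\le B^2$ and $\mathbb E_\xi\|\mathcal G_y(z;\xi)\|^2\le B^2$ almost surely at every point $z=z^k_t$ visited by the algorithm below. **Algorithm.** Put $\gamma=\mu/4$, fix $0<\eta_0\le1/\rho$, and for $k\ge1$ let $$\eta_k=\eta_0e^{-(k-1)/16},\qquad T_k=\left\lceil\frac{768}{\eta_0\min\{\mu/8,\mu_y\}}e^{(k-1)/16}\right\rceil .$$ Epoch $k=1,2,\dots$ starts at $z^k_0=(x^k_0,y^k_0)=(x_{k-1},y_{k-1})$, performs for $t=1,\dots,T_k$ the SGDA step $$z^k_t=\operatorname*{arg\,min}_{(x,y)\in\mathbb R^d\times Y}\ \eta_k\langle\mathcal G_x(z^k_{t-1};\xi^k_{t-1}),x\rangle-\eta_k\langle\mathcal G_y(z^k_{t-1};\xi^k_{t-1}),y\rangle+\tfrac12\|(x,y)-z^k_{t-1}\|^2+\tfrac{\gamma\eta_k}2\|x-x^k_0\|^2$$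 with independent samples $\xi^k_t\sim\nu$, and outputs the average $(x_k,y_k)=\frac1{T_k}\sum_{t=1}^{T_k}z^k_t$. With $f_k(x,y)=f(x,y)+\frac\gamma2\|x-x^k_0\|^2$ define $$\Delta_k=475\,(P(x^k_0)-P(x_*))+57\,\mathrm{Gap}_{f_k}(x^k_0,y^k_0).$$ **Theorem.** (a) For every $\epsilon>0$ and every integer $K\ge1$ with $K\ge\max\{16\log\frac{1200\epsilon_0}\epsilon,\ 16\log\frac{6000\,\eta_0KB^2}\epsilon\}$, $\Delta_{K+1}$ is integrable and $\mathbb E[\Delta_{K+1}]\le\epsilon$. (b) Let $K$ be the least integer as in (a). It exists for $0<\epsilon\le\epsilon_0$. The total iteration complexity $\sum_{k=1}^KT_k$ is $\widetilde O\big(\frac{B^2}{\min\{\mu,\mu_y\}\epsilon}\big)$ as $\epsilon\to0$. Precisely, there is an absolute constant $C$ such that $$\sum_{k=1}^KT_k\le C\,\frac{\max\{\epsilon_0/\eta_0,\ KB^2\}}{\min\{\mu,\mu_y\}\,\epsilon}+K\quad(0<\epsilon\le\epsilon_0),\qquad \sum_{k=1}^KT_k\le C\,\frac{B^2}{\min\{\mu,\mu_y\}\,\epsilon}\log\frac1\epsilon$$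 where the second bound holds for all sufficiently small $\epsilon>0$ (how small may depend on the other parameters). -/

import Mathlib

open MeasureTheory ProbabilityTheory

namespace PES

section Problem

variable {E F : Type*} [NormedAddCommGroup E] [InnerProductSpace ℝ E]
  [NormedAddCommGroup F] [InnerProductSpace ℝ F]

/-- The primal objective `P(x) = max_{y ∈ Y} f(x, y)`. -/
noncomputable def primal (Y : Set F) (f : E → F → ℝ) (x : E) : ℝ :=
  sSup (f x '' Y)

/-- The duality gap `max_{y' ∈ Y} h(x, y') - min_{x'} h(x', y)` of `(x, y)` for the game `h`. -/
noncomputable def dualityGap (Y : Set F) (h : E → F → ℝ) (x : E) (y : F) : ℝ :=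
  sSup (h x '' Y) - sInf (Set.range fun x' => h x' y)

/-- The proximal objective `f(x, y) + (γ / 2) ‖x - c‖ ^ 2` with reference point `c`. -/
noncomputable def proximal (f : E → F → ℝ) (γ : ℝ) (c : E) (x : E) (y : F) : ℝ :=
  f x y + γ / 2 * ‖x - c‖ ^ 2

/-- The Lyapunov function at the starting point `z = (x_0^k, y_0^k)` of an epoch:
`475 (P(x_0^k) - P(x_*)) + 57 Gap_k(x_0^k, y_0^k)`, where `Gap_k` is the duality gap of the
proximal objective whose reference point is `x_0^k` itself. -/
noncomputable def lyapunov (Y : Set F) (f : E → F → ℝ) (γ : ℝ) (xstar : E) (z : E × F) : ℝ :=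
  475 * (primal Y f z.1 - primal Y f xstar)
    + 57 * dualityGap Y (proximal f γ z.1) z.1 z.2

/-- `h` is `ρ`-weakly convex, `g` being its gradient. -/
def WeaklyConvex (ρ : ℝ) (h : E → ℝ) (g : E → E) : Prop :=
  ∀ x x', inner ℝ (g x') (x - x') - ρ / 2 * ‖x - x'‖ ^ 2 ≤ h x - h x'

/-- `h` is `L`-smooth: differentiable with `L`-Lipschitz gradient. -/
def LSmooth [CompleteSpace E] (L : ℝ) (h : E → ℝ) : Prop :=
  Differentiable ℝ h ∧ ∀ x x', ‖gradient h x - gradient h x'‖ ≤ L * ‖x - x'‖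

/-- The `μ`-PL condition, `xstar` being a global minimizer of `h`. -/
def PLCondition [CompleteSpace E] (μ : ℝ) (h : E → ℝ) (xstar : E) : Prop :=
  ∀ x, 2 * μ * (h x - h xstar) ≤ ‖gradient h x‖ ^ 2

/-- `gx` and `gy` are the partial gradients of `f` on `E × Y`. The `y`-derivative is taken within
`Y`, so that nothing is required of `f` outside of `E × Y`. -/
def HasPartialGradients [CompleteSpace E] [CompleteSpace F] (Y : Set F) (f : E → F → ℝ)
    (gx : E → F → E) (gy : E → F → F) : Prop :=
  ∀ x, ∀ y ∈ Y, HasGradientAt (fun x' => f x' y) (gx x y) x ∧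
    HasGradientWithinAt (fun y' => f x y') (gy x y) Y y

/-- The field `F(z) = (∇_x f, -∇_y f)` is `ℓ`-Lipschitz on `E × Y` for the Euclidean norm
`‖(x, y)‖ ^ 2 = ‖x‖ ^ 2 + ‖y‖ ^ 2`. -/
def LipschitzField (Y : Set F) (ℓ : ℝ) (gx : E → F → E) (gy : E → F → F) : Prop :=
  ∀ x x', ∀ y ∈ Y, ∀ y' ∈ Y,
    Real.sqrt (‖gx x y - gx x' y'‖ ^ 2 + ‖gy x y - gy x' y'‖ ^ 2)
      ≤ ℓ * Real.sqrt (‖x - x'‖ ^ 2 + ‖y - y'‖ ^ 2)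

end Problem

section Algorithm

open Classical in
/-- A minimizer of `φ` over `Z` (and `dflt` if there is none). -/
noncomputable def argminOn {α : Type*} (Z : Set α) (φ : α → ℝ) (dflt : α) : α :=
  if h : ∃ z, z ∈ Z ∧ ∀ w ∈ Z, φ z ≤ φ w then h.choose else dflt

variable {E F S : Type*} [NormedAddCommGroup E] [InnerProductSpace ℝ E]
  [NormedAddCommGroup F] [InnerProductSpace ℝ F]

/-- The update `argmin_{z ∈ E × Y} ⟨v, z⟩ + ‖z - zbar‖ ^ 2 / 2 + (c / 2) ‖x - x0‖ ^ 2`.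
The objective is strongly convex: for `c ≥ 0` and `Y` nonempty, closed and convex in finite
dimension the minimizer exists and is unique. -/
noncomputable def proxStep (Y : Set F) (c : ℝ) (x0 : E) (zbar v : E × F) : E × F :=
  argminOn {z : E × F | z.2 ∈ Y}
    (fun z => inner ℝ v.1 z.1 + inner ℝ v.2 z.2
      + 1 / 2 * (‖z.1 - zbar.1‖ ^ 2 + ‖z.2 - zbar.2‖ ^ 2) + c / 2 * ‖z.1 - x0‖ ^ 2) zbar

/-- The inner iterates `z_0, z_1, …` of SGDA with stochastic gradients `Gx`, `Gy`, step size `η`,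
regularization `γ`, starting point `z0 = (x_0, y_0)` and samples `s 0, s 1, …`:
`z_t` is the update from `z_{t-1}` along `η (Gx, -Gy)` at `(z_{t-1}; s_{t-1})`, with the term
`(γ η / 2) ‖x - x_0‖ ^ 2`. -/
noncomputable def sgda (Y : Set F) (Gx : E → F → S → E) (Gy : E → F → S → F) (γ η : ℝ)
    (z0 : E × F) (s : ℕ → S) : ℕ → E × F
  | 0 => z0
  | t + 1 =>
    let z := sgda Y Gx Gy γ η z0 s t
    proxStep Y (γ * η) z0.1 z (η • Gx z.1 z.2 (s t), -(η • Gy z.1 z.2 (s t)))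

/-- The output `(1 / T) ∑_{t=1}^T z_t` of `T` steps of SGDA. -/
noncomputable def sgdaAverage (Y : Set F) (Gx : E → F → S → E) (Gy : E → F → S → F) (γ η : ℝ)
    (T : ℕ) (z0 : E × F) (s : ℕ → S) : E × F :=
  (T : ℝ)⁻¹ • ∑ t ∈ Finset.Icc 1 T, sgda Y Gx Gy γ η z0 s t

/-- The outer iterates `(x_k, y_k)` of the proximal epoch stochastic method with SGDA as inner
solver: epoch `k ≥ 1` starts at `(x_0^k, y_0^k) = (x_{k-1}, y_{k-1})`, uses step size `η k`,
`T k` inner steps and the samples `s k 0, s k 1, …`, and returns the average. -/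
noncomputable def pes (Y : Set F) (Gx : E → F → S → E) (Gy : E → F → S → F) (γ : ℝ)
    (η : ℕ → ℝ) (T : ℕ → ℕ) (z0 : E × F) (s : ℕ → ℕ → S) : ℕ → E × F
  | 0 => z0
  | k + 1 => sgdaAverage Y Gx Gy γ (η (k + 1)) (T (k + 1)) (pes Y Gx Gy γ η T z0 s k) (s (k + 1))

/-- The inner iterate `z_t` of epoch `k + 1`. -/
noncomputable def pesInner (Y : Set F) (Gx : E → F → S → E) (Gy : E → F → S → F) (γ : ℝ)
    (η : ℕ → ℝ) (T : ℕ → ℕ) (z0 : E × F) (s : ℕ → ℕ → S) (k t : ℕ) : E × F :=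
  sgda Y Gx Gy γ (η (k + 1)) (pes Y Gx Gy γ η T z0 s k) (s (k + 1)) t

end Algorithm

/-- The step size `η_k = η_0 exp (-(k - 1) / 16)` of epoch `k ≥ 1`. -/
noncomputable def stepSize (η₀ : ℝ) (k : ℕ) : ℝ :=
  η₀ * Real.exp (-((k : ℝ) - 1) / 16)

/-- The number of inner steps `T_k = 768 / (η_0 min {μ / 8, μ_y}) exp ((k - 1) / 16)` of epoch
`k ≥ 1`, rounded up to an integer. -/
noncomputable def epochLength (η₀ μ μy : ℝ) (k : ℕ) : ℕ :=
  ⌈768 / (η₀ * min (μ / 8) μy) * Real.exp (((k : ℝ) - 1) / 16)⌉₊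

/-- The number `K ≥ 1` of epochs is sufficient for accuracy `ε`:
`K ≥ max {16 log (1200 ε_0 / ε), 16 log (6000 η_0 K B ^ 2 / ε)}`. -/
def EnoughEpochs (ε₀ η₀ B ε : ℝ) (K : ℕ) : Prop :=
  1 ≤ K ∧ max (16 * Real.log (1200 * ε₀ / ε)) (16 * Real.log (6000 * η₀ * K * B ^ 2 / ε)) ≤ K

/-- The total number of inner iterations, that is of stochastic gradient calls, in `K` epochs. -/
noncomputable def totalIterations (η₀ μ μy : ℝ) (K : ℕ) : ℕ :=
  ∑ k ∈ Finset.Icc 1 K, epochLength η₀ μ μy k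

end PES

/-! Since ρ ≤ μ/8, the term `γ/2 ‖x - c‖²` with γ = μ/4 makes the game strongly convex in x, with
modulus γ - ρ ≥ μ/8, while it stays μ_y-strongly concave in y. Each epoch solves such a game
approximately, centred at its own starting point, and the Lyapunov function is passed from one
centre to the next.

Deterministic half. PL gives quadratic growth of P, so comparing the output x₁ with a minimizer of P
near x₀ halves P - P* up to the proximal gap, and leaves a term `μ/8 ‖x₁ - x₀‖²` to spare. That term
pays for recentring the game at x₁ (`lyapunov_le`). The comparators that realize the gap are the
best responses to the output; their squared distance from the starting point is controlled by the
old and the new gap through the saddle point (`exists_dualityGap_eq_dist_le`). Hence a gap estimate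
`a * distance² + r` with small a halves the Lyapunov function up to a multiple of r
(`lyapunov_contraction`).

Stochastic half. These comparators depend on all samples of the epoch, so expectations cannot be
taken with the comparator fixed. The regret bound `sum_inner_le_noise` is therefore pathwise:
Young's inequality separates the comparator from the accumulated gradient error, and the remaining
`noise` does not see the comparator. Its mean is at most ηB²(T + 1) (`integral_noise_le`), so r is
of order ηB² in expectation.

The recursion "half the old value plus O(η_k B²)" with η_k shrinking by exp(-1/16) solves to
exp(-k/16)(D + O(k η₀B²)); the factor k is the source of the K inside the logarithm. Epoch lengths
grow geometrically, so their sum is of order exp(K/16), and the minimality of K bounds that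
exponential. -/

namespace PES

open Filter Topology Set

/-! ### Strong concavity and existence of extremizers. -/

section Convexity

variable {H : Type*} [NormedAddCommGroup H]

/-- A weak form of coercivity is enough: if `z₀` already beats every far point, the minimum over a
compact ball is global. -/
theorem exists_forall_le_of_le_far [ProperSpace H] {s : Set H} {φ : H → ℝ} (hs : IsClosed s)
    (hφ : ContinuousOn φ s) {z₀ : H} (hz₀ : z₀ ∈ s) (R : ℝ)
    (h : ∀ z ∈ s, R < ‖z - z₀‖ → φ z₀ ≤ φ z) : ∃ z ∈ s, ∀ w ∈ s, φ z ≤ φ w := by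
  have hc : IsCompact (s ∩ Metric.closedBall z₀ (max R 0)) :=
    (isCompact_closedBall _ _).inter_left hs
  have h0 : z₀ ∈ s ∩ Metric.closedBall z₀ (max R 0) := ⟨hz₀, by simp⟩
  obtain ⟨z, hz, hmin⟩ := hc.exists_isMinOn ⟨z₀, h0⟩ (hφ.mono inter_subset_left)
  refine ⟨z, hz.1, fun w hw => ?_⟩
  by_cases hR : ‖w - z₀‖ ≤ max R 0
  · exact hmin ⟨hw, by simpa [dist_eq_norm] using hR⟩
  · exact (hmin h0).trans (h w hw (lt_of_le_of_lt (le_max_left _ _) (not_le.1 hR)))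

variable [InnerProductSpace ℝ H]

theorem _root_.StrongConcaveOn.segment_le {s : Set H} {m : ℝ} {φ : H → ℝ}
    (h : StrongConcaveOn s m φ) {y y' : H} (hy : y ∈ s) (hy' : y' ∈ s) {t : ℝ} (ht : 0 ≤ t)
    (ht1 : t ≤ 1) :
    φ y + t * (φ y' - φ y + (1 - t) * (m / 2 * ‖y' - y‖ ^ 2)) ≤ φ (y + t • (y' - y)) := by
  have := h.2 hy hy' (show 0 ≤ 1 - t by linarith) ht (by ring)
  have e : (1 - t) • y + t • y' = y + t • (y' - y) := by module
  rw [e] at this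
  rw [norm_sub_rev y' y]
  simp only [smul_eq_mul] at this
  linarith

/-- Divide the concavity inequality by t and let t tend to 0 from the right. The gradient is only
taken within `s`, so the limit runs along the segment, which convexity keeps inside `s`. -/
theorem _root_.StrongConcaveOn.le_add_inner [CompleteSpace H] {s : Set H} {m : ℝ} {φ : H → ℝ}
    (h : StrongConcaveOn s m φ) {y y' g : H} (hg : HasGradientWithinAt φ g s y) (hy : y ∈ s)
    (hy' : y' ∈ s) : φ y' ≤ φ y + inner ℝ g (y' - y) - m / 2 * ‖y' - y‖ ^ 2 := by
  set d := y' - y with hd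
  have hline : HasDerivWithinAt (fun t : ℝ => y + t • d) d (Icc 0 1) 0 := by
    have : HasDerivAt (fun t : ℝ => y + t • d) ((1 : ℝ) • d) 0 :=
      ((hasDerivAt_id (0 : ℝ)).smul_const d).const_add y
    simpa using this.hasDerivWithinAt
  have hmaps : MapsTo (fun t : ℝ => y + t • d) (Icc 0 1) s := fun t ht => h.1.add_smul_sub_mem hy hy' ht
  have hg' : HasFDerivWithinAt φ (InnerProductSpace.toDual ℝ H g) s (y + (0 : ℝ) • d) := by
    simpa using hg.hasFDerivWithinAt
  have hder := hg'.comp_hasDerivWithinAt (0 : ℝ) hline hmaps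
  rw [InnerProductSpace.toDual_apply_apply, hasDerivWithinAt_iff_tendsto_slope] at hder
  have hlim : Tendsto (fun t : ℝ => φ y' - φ y + (1 - t) * (m / 2 * ‖d‖ ^ 2))
      (𝓝[Icc 0 1 \ {0}] (0 : ℝ)) (𝓝 (φ y' - φ y + (1 - 0) * (m / 2 * ‖d‖ ^ 2))) :=
    (Continuous.tendsto (by fun_prop) _).mono_left nhdsWithin_le_nhds
  have hne : (𝓝[Icc (0 : ℝ) 1 \ {0}] (0 : ℝ)).NeBot := by
    have e : Icc (0 : ℝ) 1 \ {0} = Ioc 0 1 := by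
      ext t; simp only [Set.mem_sdiff, mem_Icc, mem_singleton_iff, mem_Ioc]
      constructor
      · rintro ⟨⟨a, b⟩, c⟩; exact ⟨lt_of_le_of_ne a (Ne.symm c), b⟩
      · rintro ⟨a, b⟩; exact ⟨⟨a.le, b⟩, a.ne'⟩
    rw [e, nhdsWithin_Ioc_eq_nhdsGT zero_lt_one]
    infer_instance
  have := le_of_tendsto_of_tendsto hlim hder (by
    filter_upwards [self_mem_nhdsWithin] with t ht
    have ht0 : 0 < t := lt_of_le_of_ne ht.1.1 (Ne.symm ht.2)
    have := h.segment_le hy hy' ht.1.1 ht.1.2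
    rw [slope_def_field, le_div_iff₀ (by simpa using ht0)]
    simp only [Function.comp, zero_smul, add_zero, sub_zero]
    linarith)
  linarith

theorem _root_.StrongConcaveOn.le_sub_of_isMax {s : Set H} {m : ℝ} {φ : H → ℝ}
    (h : StrongConcaveOn s m φ) {y y' : H} (hy : y ∈ s) (hmax : ∀ w ∈ s, φ w ≤ φ y)
    (hy' : y' ∈ s) : φ y' ≤ φ y - m / 2 * ‖y' - y‖ ^ 2 := by
  by_contra hcon
  push Not at hcon
  set A := m / 2 * ‖y' - y‖ ^ 2 with hA
  have hB : φ y' ≤ φ y := hmax y' hy'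
  have hApos : 0 < A := by linarith
  -- Maximality gives `(1 - t) * A ≤ φ y - φ y'` for every small t > 0; this t uses up exactly half
  -- of the assumed excess, so the other half contradicts it.
  set t := (A - (φ y - φ y')) / (2 * A) with ht
  have ht0 : 0 < t := div_pos (by linarith) (by linarith)
  have ht1 : t ≤ 1 := by rw [ht, div_le_one (by linarith)]; linarith
  have h1 := h.segment_le hy hy' ht0.le ht1
  rw [← hA] at h1
  have hmem : y + t • (y' - y) ∈ s := h.1.add_smul_sub_mem hy hy' ⟨ht0.le, ht1⟩
  have h2 := hmax _ hmem
  have h3 : φ y' - φ y + (1 - t) * A ≤ 0 := by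
    by_contra h4; push Not at h4
    nlinarith [mul_pos ht0 h4]
  have h5 : t * A = (A - (φ y - φ y')) / 2 := by rw [ht]; field_simp
  nlinarith

theorem _root_.StrongConcaveOn.exists_forall_le [ProperSpace H] {s : Set H} {m : ℝ} {φ : H → ℝ}
    (hm : 0 < m) (h : StrongConcaveOn s m φ) (hs : IsClosed s) (hne : s.Nonempty) {g : H → H}
    (hg : ∀ y ∈ s, HasGradientWithinAt φ (g y) s y) : ∃ y ∈ s, ∀ w ∈ s, φ w ≤ φ y := by
  obtain ⟨y₀, hy₀⟩ := hne
  have hcont : ContinuousOn (fun y => - φ y) s :=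
    ContinuousOn.neg fun y hy => (hg y hy).hasFDerivWithinAt.continuousWithinAt
  obtain ⟨z, hz, hmin⟩ := exists_forall_le_of_le_far hs hcont hy₀ (2 * ‖g y₀‖ / m) (by
    intro z hz hR
    have h1 := h.le_add_inner (hg y₀ hy₀) hy₀ hz
    have h2 := real_inner_le_norm (g y₀) (z - y₀)
    rw [div_lt_iff₀ hm] at hR
    nlinarith [norm_nonneg (z - y₀)])
  exact ⟨z, hz, fun w hw => by linarith [hmin w hw]⟩

end Convexity

theorem _root_.HasDerivAt.nonneg_of_forall_le {θ : ℝ → ℝ} {θ' : ℝ} (h : HasDerivAt θ θ' 0)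
    (hmin : ∀ s, 0 < s → θ 0 ≤ θ s) : 0 ≤ θ' := by
  have := (hasDerivAt_iff_tendsto_slope.1 h).mono_left
    (nhdsWithin_mono (0 : ℝ) (fun s (hs : s ∈ Ioi 0) => ne_of_gt hs))
  refine ge_of_tendsto this ?_
  filter_upwards [self_mem_nhdsWithin] with s hs
  rw [slope_def_field]
  exact div_nonneg (sub_nonneg.2 (hmin s hs)) (by simpa using le_of_lt hs)

theorem mul_norm_sub_sq_le {H : Type*} [NormedAddCommGroup H] {m : ℝ} (hm : 0 ≤ m) (a b s : H) :
    m / 4 * ‖a - b‖ ^ 2 ≤ m / 2 * ‖s - a‖ ^ 2 + m / 2 * ‖b - s‖ ^ 2 := by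
  have h1 : ‖a - b‖ ≤ ‖s - a‖ + ‖b - s‖ := by
    rw [norm_sub_rev a b, add_comm]; exact norm_sub_le_norm_sub_add_norm_sub b s a
  have h2 : ‖a - b‖ ^ 2 ≤ (‖s - a‖ + ‖b - s‖) ^ 2 := by gcongr
  nlinarith [mul_nonneg hm (sq_nonneg (‖s - a‖ - ‖b - s‖)), mul_le_mul_of_nonneg_left h2 hm]

/-! ### Quadratic growth under PL and the deterministic Lyapunov analysis. -/

section

variable {E F : Type*} [NormedAddCommGroup E] [InnerProductSpace ℝ E] [ProperSpace E]
  [NormedAddCommGroup F] [InnerProductSpace ℝ F] [ProperSpace F]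

/-- Quadratic growth around the set of minimizers under the PL condition. -/
theorem PLCondition.exists_quadratic_growth {P : E → ℝ} {μ : ℝ} {xstar : E} (hμ : 0 < μ)
    (hP : Differentiable ℝ P) (hmin : ∀ x, P xstar ≤ P x) (hpl : PLCondition μ P xstar) (x : E) :
    ∃ u, P u = P xstar ∧ μ / 4 * ‖u - x‖ ^ 2 ≤ P x - P xstar := by
  -- PL bounds the slope of `√(P - P*)` below by `√(μ/2)`. Choosing κ strictly smaller leads to a
  -- strict contradiction, at the price of μ/4 in place of the sharp μ/2.
  set κ := Real.sqrt μ / 2 with hκ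
  have hκ0 : 0 < κ := by positivity
  have hκ2 : κ ^ 2 = μ / 4 := by rw [hκ, div_pow, Real.sq_sqrt hμ.le]; norm_num
  set φ : E → ℝ := fun u => Real.sqrt (P u - P xstar) with hφ
  have hφ0 : ∀ u, 0 ≤ φ u := fun u => Real.sqrt_nonneg _
  have hφ2 : ∀ u, φ u ^ 2 = P u - P xstar := fun u => Real.sq_sqrt (sub_nonneg.2 (hmin u))
  have hcont : Continuous fun u => φ u + κ * ‖u - x‖ := by
    have := hP.continuous
    fun_prop
  obtain ⟨u, -, hu⟩ := exists_forall_le_of_le_far isClosed_univ hcont.continuousOn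
    (mem_univ x) (φ x / κ) (by
      intro z _ hz
      rw [div_lt_iff₀ hκ0] at hz
      simp only [sub_self, norm_zero, mul_zero, add_zero]
      nlinarith [hφ0 z])
  have hux := hu x (mem_univ _)
  simp only [sub_self, norm_zero, mul_zero, add_zero] at hux
  -- Ekeland-type argument: at a minimizer u of `√(P - P*) + κ ‖· - x‖`, moving against the gradient
  -- shows that the slope of `√(P - P*)` is at most κ unless it is not differentiable there, that
  -- is, unless P u = P*.
  have hu0 : P u = P xstar := by
    by_contra hne
    have hpos : 0 < P u - P xstar :=
      sub_pos.2 (lt_of_le_of_ne (hmin u) (Ne.symm hne))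
    have hφpos : 0 < φ u := Real.sqrt_pos.2 hpos
    set G := gradient P u with hG
    have hline : HasDerivAt (fun s : ℝ => u - s • G) (-G) 0 := by
      simpa using ((hasDerivAt_id (0 : ℝ)).smul_const G).const_sub u
    have hg : HasFDerivAt P (InnerProductSpace.toDual ℝ E G) (u - (0 : ℝ) • G) := by
      rw [zero_smul, sub_zero]
      exact (hP u).hasGradientAt.hasFDerivAt
    have h1 := ((hg.comp_hasDerivAt (0 : ℝ) hline).sub_const (P xstar)).sqrt (by
      simpa using hpos.ne')
    have h2 := h1.add ((hasDerivAt_id (0 : ℝ)).const_mul (κ * ‖G‖))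
    have h3 := h2.nonneg_of_forall_le (by
      intro s hs
      have h4 := hu (u - s • G) (mem_univ _)
      have h5 : ‖u - s • G - x‖ ≤ ‖u - x‖ + s * ‖G‖ := by
        have : u - s • G - x = (u - x) - s • G := by abel
        rw [this]
        refine (norm_sub_le _ _).trans ?_
        rw [norm_smul, Real.norm_of_nonneg hs.le]
      have h6 := mul_le_mul_of_nonneg_left h5 hκ0.le
      simp only [hφ] at h4
      simp only [Pi.add_apply, Function.comp, zero_smul, sub_zero, id, mul_zero, add_zero]
      linarith)
    simp only [InnerProductSpace.toDual_apply_apply, Function.comp, zero_smul, sub_zero,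
      inner_neg_right, real_inner_self_eq_norm_sq, mul_one] at h3
    have h7 : ‖G‖ ^ 2 / (2 * φ u) ≤ κ * ‖G‖ := by
      rw [neg_div] at h3; linarith
    rw [div_le_iff₀ (by linarith)] at h7
    have h8 := hpl u
    rw [← hφ2 u] at h8
    have hGpos : 0 < ‖G‖ := by
      by_contra hcon
      have : ‖G‖ = 0 := le_antisymm (not_lt.1 hcon) (norm_nonneg _)
      rw [← hG, this] at h8
      nlinarith [mul_pos hμ (pow_pos hφpos 2)]
    have h9 : ‖G‖ ≤ 2 * κ * φ u := by
      by_contra hcon; push Not at hcon; nlinarith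
    have h10 : ‖G‖ ^ 2 ≤ (2 * κ * φ u) ^ 2 := by gcongr
    have h11 : (2 * κ * φ u) ^ 2 = μ * φ u ^ 2 := by rw [mul_pow, mul_pow, hκ2]; ring
    nlinarith [mul_pos hμ (pow_pos hφpos 2)]
  refine ⟨u, hu0, ?_⟩
  have : κ * ‖u - x‖ ≤ φ x := by linarith [hφ0 u]
  calc μ / 4 * ‖u - x‖ ^ 2 = (κ * ‖u - x‖) ^ 2 := by rw [mul_pow, hκ2]
    _ ≤ φ x ^ 2 := by gcongr
    _ = _ := hφ2 x

/-- The deterministic assumptions of the method. -/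
structure SaddleProblem (Y : Set F) (f : E → F → ℝ) (gx : E → F → E) (gy : E → F → F)
    (μ μy ρ : ℝ) (xstar : E) : Prop where
  nonempty : Y.Nonempty
  isClosed : IsClosed Y
  convex : Convex ℝ Y
  mu_pos : 0 < μ
  muy_pos : 0 < μy
  rho_le : ρ ≤ μ / 8
  grad : HasPartialGradients Y f gx gy
  strongConcave : ∀ x, StrongConcaveOn Y μy (f x)
  differentiable : Differentiable ℝ (primal Y f)
  isMin : ∀ x, primal Y f xstar ≤ primal Y f x
  pl : PLCondition μ (primal Y f) xstar
  weaklyConvex : ∀ y ∈ Y, WeaklyConvex ρ (fun x => f x y) (fun x => gx x y)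

namespace SaddleProblem

variable {Y : Set F} {f : E → F → ℝ} {gx : E → F → E} {gy : E → F → F} {μ μy ρ : ℝ} {xstar : E}
  (h : SaddleProblem Y f gx gy μ μy ρ xstar)

include h

theorem exists_primal_eq (x : E) : ∃ y ∈ Y, primal Y f x = f x y ∧
    ∀ w ∈ Y, f x w ≤ f x y - μy / 2 * ‖w - y‖ ^ 2 := by
  obtain ⟨y, hy, hmax⟩ := (h.strongConcave x).exists_forall_le h.muy_pos h.isClosed h.nonempty
    (fun y hy => (h.grad x y hy).2)
  refine ⟨y, hy, ?_, fun w hw => (h.strongConcave x).le_sub_of_isMax hy hmax hw⟩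
  exact IsGreatest.csSup_eq ⟨mem_image_of_mem _ hy, by rintro _ ⟨w, hw, rfl⟩; exact hmax w hw⟩

theorem le_primal (x : E) {y : F} (hy : y ∈ Y) : f x y ≤ primal Y f x := by
  obtain ⟨y', hy', he, hg⟩ := h.exists_primal_eq x
  have := h.muy_pos
  have : 0 ≤ μy / 2 * ‖y - y'‖ ^ 2 := by positivity
  linarith [hg y hy]

theorem le_proximal (γ : ℝ) (c : E) {y : F} (hy : y ∈ Y) (x x' : E) :
    proximal f γ c x' y + inner ℝ (gx x' y + γ • (x' - c)) (x - x')
      + (γ - ρ) / 2 * ‖x - x'‖ ^ 2 ≤ proximal f γ c x y := by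
  have h1 := h.weaklyConvex y hy x x'
  have h2 : ‖x - c‖ ^ 2 = ‖x - x'‖ ^ 2 + 2 * inner ℝ (x' - c) (x - x') + ‖x' - c‖ ^ 2 := by
    rw [← sub_add_sub_cancel x x' c, norm_add_sq_real, real_inner_comm]
  simp only at h1
  rw [proximal, proximal, h2, inner_add_left, real_inner_smul_left]
  linarith

theorem hasGradientAt_proximal (γ : ℝ) (c : E) {y : F} (hy : y ∈ Y) (x : E) :
    HasGradientAt (fun x => proximal f γ c x y) (gx x y + γ • (x - c)) x := by
  have h1 := (h.grad x y hy).1.hasFDerivAt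
  have h2 := (((hasFDerivAt_id (𝕜 := ℝ) x).sub_const c).norm_sq).const_mul (γ / 2)
  have h3 := h1.add h2
  have e : InnerProductSpace.toDual ℝ E (gx x y + γ • (x - c)) =
      InnerProductSpace.toDual ℝ E (gx x y) +
        (γ / 2) • 2 • (innerSL ℝ (id x - c)).comp (ContinuousLinearMap.id ℝ E) := by
    ext v
    simp
    ring
  rw [hasGradientAt_iff_hasFDerivAt, e]
  exact h3

theorem growth_of_grad_eq_zero {γ : ℝ} {c : E} {y : F} (hy : y ∈ Y) {x' : E}
    (h0 : gx x' y + γ • (x' - c) = 0) (x : E) :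
    proximal f γ c x' y + (γ - ρ) / 2 * ‖x - x'‖ ^ 2 ≤ proximal f γ c x y := by
  simpa [h0] using h.le_proximal γ c hy x x'

theorem exists_proximal_min {γ : ℝ} (hγ : ρ < γ) (c : E) {y : F} (hy : y ∈ Y) :
    ∃ x', ∀ x, proximal f γ c x' y + (γ - ρ) / 2 * ‖x - x'‖ ^ 2 ≤ proximal f γ c x y := by
  have hcont : Continuous fun x => proximal f γ c x y :=
    continuous_iff_continuousAt.2 fun x =>
      (h.hasGradientAt_proximal γ c hy x).hasFDerivAt.continuousAt
  obtain ⟨z, -, hz⟩ := exists_forall_le_of_le_far isClosed_univ hcont.continuousOn (mem_univ c)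
    (2 * ‖gx c y + γ • (c - c)‖ / (γ - ρ)) (by
      intro z _ hR
      have h1 := h.le_proximal γ c hy z c
      have h2 := neg_le_of_abs_le (abs_real_inner_le_norm (gx c y + γ • (c - c)) (z - c))
      rw [div_lt_iff₀ (by linarith)] at hR
      nlinarith [norm_nonneg (z - c)])
  refine ⟨z, h.growth_of_grad_eq_zero hy ?_⟩
  have hmin : IsLocalMin (fun x => proximal f γ c x y) z := Eventually.of_forall fun w => hz w trivial
  have := hmin.hasFDerivAt_eq_zero (h.hasGradientAt_proximal γ c hy z).hasFDerivAt
  exact (LinearIsometryEquiv.map_eq_zero_iff _).1 this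

/-- No minimax theorem is needed: take `xs` minimizing P plus the proximal term and `ys` the
maximizer at `xs`. Stationarity of the first transfers to the game by Danskin's argument, and strong
convexity turns it into growth. -/
theorem exists_saddle {γ : ℝ} (hγ0 : 0 < γ) (c : E) : ∃ xs, ∃ ys ∈ Y,
    (∀ x, proximal f γ c xs ys + (γ - ρ) / 2 * ‖x - xs‖ ^ 2 ≤ proximal f γ c x ys) ∧
    ∀ y ∈ Y, proximal f γ c xs y ≤ proximal f γ c xs ys - μy / 2 * ‖y - ys‖ ^ 2 := by
  have hPc := h.differentiable.continuous
  obtain ⟨xs, -, hxs⟩ := exists_forall_le_of_le_far isClosed_univ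
    (φ := fun x => primal Y f x + γ / 2 * ‖x - c‖ ^ 2) (by fun_prop) (mem_univ c)
    -- The summand 1 guarantees that the square of the radius dominates the fraction, avoiding a
    -- square root.
    (1 + 2 * (primal Y f c - primal Y f xstar) / γ) (by
      intro z _ hR
      have h1 := h.isMin z
      have h2 := h.isMin c
      have h3 : 0 ≤ 2 * (primal Y f c - primal Y f xstar) / γ :=
        div_nonneg (by linarith) hγ0.le
      have h4 : 2 * (primal Y f c - primal Y f xstar) / γ ≤ ‖z - c‖ ^ 2 := by nlinarith
      rw [div_le_iff₀ hγ0] at h4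
      simp only [sub_self, norm_zero]
      nlinarith)
  obtain ⟨ys, hys, he, hg⟩ := h.exists_primal_eq xs
  refine ⟨xs, ys, hys, h.growth_of_grad_eq_zero hys ?_, fun y hy => by
    simp only [proximal]; linarith [hg y hy]⟩
  have hder := (h.differentiable xs).hasFDerivAt
  have hminP : IsLocalMin (fun x => primal Y f x + γ / 2 * ‖x - c‖ ^ 2) xs :=
    Eventually.of_forall fun w => hxs w trivial
  have hminD : IsLocalMin (fun x => primal Y f x - f x ys) xs :=
    -- Danskin: P - f(·, ys) is nonnegative and vanishes at `xs`, so the two gradients agree there.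
    Eventually.of_forall fun w => by
      simp only [he, sub_self]; linarith [h.le_primal w hys]
  have hf := (h.grad xs ys hys).1.hasFDerivAt
  have e1 := hminD.hasFDerivAt_eq_zero (hder.sub hf)
  have hq := (((hasFDerivAt_id (𝕜 := ℝ) xs).sub_const c).norm_sq).const_mul (γ / 2)
  have e2 := hminP.hasFDerivAt_eq_zero (hder.add hq)
  have e3 := (hf.add hq).unique ((h.hasGradientAt_proximal γ c hys xs).hasFDerivAt)
  rw [sub_eq_zero] at e1
  rw [e1] at e2
  rw [e2] at e3
  exact (LinearIsometryEquiv.map_eq_zero_iff _).1 e3.symm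

theorem exists_dualityGap_eq {γ : ℝ} (hγ : ρ < γ) (c x : E) {y : F} (hy : y ∈ Y) :
    ∃ x', ∃ y' ∈ Y,
      dualityGap Y (proximal f γ c) x y = proximal f γ c x y' - proximal f γ c x' y ∧
      primal Y f x = f x y' ∧
      (∀ w, proximal f γ c x' y + (γ - ρ) / 2 * ‖w - x'‖ ^ 2 ≤ proximal f γ c w y) ∧
      ∀ w ∈ Y, f x w ≤ f x y' - μy / 2 * ‖w - y'‖ ^ 2 := by
  obtain ⟨x', hx'⟩ := h.exists_proximal_min hγ c hy
  obtain ⟨y', hy', he, hg⟩ := h.exists_primal_eq x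
  refine ⟨x', y', hy', ?_, he, hx', hg⟩
  rw [dualityGap]
  congr 1
  · refine IsGreatest.csSup_eq ⟨mem_image_of_mem _ hy', ?_⟩
    rintro _ ⟨w, hw, rfl⟩
    have := h.le_primal x hw
    simp only [proximal]; linarith
  · refine IsLeast.csInf_eq ⟨mem_range_self _, ?_⟩
    rintro _ ⟨w, rfl⟩
    have : 0 ≤ (γ - ρ) / 2 * ‖w - x'‖ ^ 2 := mul_nonneg (by linarith) (sq_nonneg _)
    linarith [hx' w]

theorem sub_le_dualityGap {γ : ℝ} (hγ : ρ < γ) (c x w : E) {y v : F} (hy : y ∈ Y) (hv : v ∈ Y) :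
    proximal f γ c x v - proximal f γ c w y ≤ dualityGap Y (proximal f γ c) x y := by
  obtain ⟨x', y', hy', he, hp, hx, -⟩ := h.exists_dualityGap_eq hγ c x hy
  have h1 := h.le_primal x hv
  have : 0 ≤ (γ - ρ) / 2 * ‖w - x'‖ ^ 2 := mul_nonneg (by linarith) (sq_nonneg _)
  rw [he]
  have h2 : proximal f γ c x v ≤ proximal f γ c x y' := by simp only [proximal]; linarith
  linarith [hx w]

theorem dualityGap_nonneg {γ : ℝ} (hγ : ρ < γ) (c x : E) {y : F} (hy : y ∈ Y) :
    0 ≤ dualityGap Y (proximal f γ c) x y := by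
  simpa using h.sub_le_dualityGap hγ c x x hy hy

/-- Pass through the saddle point: the gap at (x₀, y₀) pays for its distance from the saddle, and
the gap at (x₁, y₁) pays for the distance of its best responses from the saddle, both by quadratic
growth. -/
theorem exists_dualityGap_eq_dist_le {γ m : ℝ} (hγ : ρ < γ) (hγ0 : 0 < γ) (hm : 0 ≤ m)
    (hm₁ : m ≤ γ - ρ)
    (hm₂ : m ≤ μy) (c x₀ x₁ : E) {y₀ y₁ : F} (hy₀ : y₀ ∈ Y) (hy₁ : y₁ ∈ Y) :
    ∃ x, ∃ y ∈ Y,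
      dualityGap Y (proximal f γ c) x₁ y₁ = proximal f γ c x₁ y - proximal f γ c x y₁ ∧
      m / 4 * (‖x - x₀‖ ^ 2 + ‖y - y₀‖ ^ 2) ≤
        dualityGap Y (proximal f γ c) x₀ y₀ + dualityGap Y (proximal f γ c) x₁ y₁ := by
  obtain ⟨x, y, hy, he, -, hx, hyg⟩ := h.exists_dualityGap_eq hγ c x₁ hy₁
  obtain ⟨x', y', hy', he', -, hx', hyg'⟩ := h.exists_dualityGap_eq hγ c x₀ hy₀
  obtain ⟨xs, ys, hys, hxs, hysg⟩ := h.exists_saddle hγ0 c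
  refine ⟨x, y, hy, he, ?_⟩
  have k1 := mul_norm_sub_sq_le hm x x₀ xs
  have k2 := mul_norm_sub_sq_le hm y y₀ ys
  have a1 : m / 2 * ‖xs - x‖ ^ 2 ≤ (γ - ρ) / 2 * ‖xs - x‖ ^ 2 := by gcongr
  have a2 : m / 2 * ‖x₀ - xs‖ ^ 2 ≤ (γ - ρ) / 2 * ‖x₀ - xs‖ ^ 2 := by gcongr
  have a3 : m / 2 * ‖ys - y‖ ^ 2 ≤ μy / 2 * ‖ys - y‖ ^ 2 := by gcongr
  have a4 : m / 2 * ‖y₀ - ys‖ ^ 2 ≤ μy / 2 * ‖y₀ - ys‖ ^ 2 := by gcongr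
  have b1 := hx xs
  have b2 := hxs x₀
  have b3 := hyg ys hys
  have b4 := hysg y₀ hy₀
  have b5 := hysg y₁ hy₁
  have b6 := hxs x₁
  have b7 := h.sub_le_dualityGap hγ c x₀ xs hy₀ hys
  have n5 : 0 ≤ μy / 2 * ‖y₁ - ys‖ ^ 2 := by have := h.muy_pos; positivity
  have n6 : 0 ≤ (γ - ρ) / 2 * ‖x₁ - xs‖ ^ 2 := mul_nonneg (by linarith) (sq_nonneg _)
  rw [he]
  have b8 : proximal f γ c x₁ ys ≤ proximal f γ c x₁ y - μy / 2 * ‖ys - y‖ ^ 2 := by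
    simp only [proximal]; linarith
  linarith

/-- One epoch from `x₀` to `(x₁, y₁)` decreases the Lyapunov function up to the duality gap of the
proximal problem that the epoch solves. -/
theorem lyapunov_le (x₀ x₁ : E) {y₁ : F} (hy₁ : y₁ ∈ Y) :
    lyapunov Y f (μ / 4) xstar (x₁, y₁) ≤
      475 / 2 * (primal Y f x₀ - primal Y f xstar)
        + 646 * dualityGap Y (proximal f (μ / 4) x₀) x₁ y₁ := by
  have hμ := h.mu_pos
  have hρ := h.rho_le
  have hγ : ρ < μ / 4 := by linarith
  obtain ⟨u, hu, hug⟩ := h.pl.exists_quadratic_growth hμ h.differentiable h.isMin x₀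
  obtain ⟨x, y, hy, he, hp, hx, -⟩ := h.exists_dualityGap_eq hγ x₀ x₁ hy₁
  obtain ⟨x', y', hy', he', hp', hx', -⟩ := h.exists_dualityGap_eq hγ x₁ x₁ hy₁
  have hmin := h.isMin x₁
  rw [lyapunov]
  simp only
  set Gap := dualityGap Y (proximal f (μ / 4) x₀) x₁ y₁ with hGap
  set Gap' := dualityGap Y (proximal f (μ / 4) x₁) x₁ y₁ with hGap'
  set D := ‖x₁ - x₀‖ with hD
  -- Compare with the minimizer u of P near x₀: its proximal cost `μ/8 ‖u - x₀‖²` is at most half of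
  -- P(x₀) - P* by quadratic growth.
  have hA : primal Y f x₁ - primal Y f xstar + μ / 8 * D ^ 2 ≤
      1 / 2 * (primal Y f x₀ - primal Y f xstar) + Gap := by
    have h1 := h.sub_le_dualityGap hγ x₀ x₁ u hy₁ hy
    have h2 := h.le_primal u hy₁
    rw [← hGap] at h1
    simp only [proximal] at h1
    rw [← hp, ← hD] at h1
    linarith
  -- Recentring from x₀ to x₁ changes the game by a cross term bounded by `μ/4 (‖x' - x‖ + ‖x₁ - x‖)
  -- D`. The growth at x' absorbs the first part at cost μ/4 D²; the second costs 2 Gap + μ/8 D²,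
  -- since the gap controls `μ/16 ‖x₁ - x‖²`.
  have hB : Gap' ≤ 3 * Gap + 3 * μ / 8 * D ^ 2 := by
    have h1 : f x' y₁ + μ / 8 * ‖x' - x₁‖ ^ 2 = f x₁ y' - Gap' := by
      rw [he']; simp only [proximal, sub_self, norm_zero]; ring
    have h2 : proximal f (μ / 4) x₀ x y₁ = f x₁ y + μ / 8 * D ^ 2 - Gap := by
      rw [he]; simp only [proximal, hD]; ring
    have h3 := hx x'
    have h4 := hx x₁
    have h5 := h.sub_le_dualityGap hγ x₀ x₁ x hy₁ hy₁
    rw [← hGap] at h5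
    have h6 : ‖x' - x₀‖ ^ 2 = ‖x' - x₁‖ ^ 2 + 2 * inner ℝ (x' - x₁) (x₁ - x₀) + D ^ 2 := by
      rw [hD, ← sub_add_sub_cancel x' x₁ x₀, norm_add_sq_real]
    have h7 : inner ℝ (x' - x₁) (x₁ - x₀) ≤ (‖x' - x‖ + ‖x₁ - x‖) * D := by
      refine (real_inner_le_norm _ _).trans ?_
      gcongr
      rw [norm_sub_rev x₁ x]
      exact norm_sub_le_norm_sub_add_norm_sub x' x x₁
    have h8 : proximal f (μ / 4) x₀ x' y₁ = f x' y₁ + μ / 8 * ‖x' - x₀‖ ^ 2 := by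
      simp only [proximal]; ring
    have h9 : μ / 16 * ‖x' - x‖ ^ 2 ≤ (μ / 4 - ρ) / 2 * ‖x' - x‖ ^ 2 := by
      exact mul_le_mul_of_nonneg_right (by linarith) (sq_nonneg _)
    have h10 : μ / 16 * ‖x₁ - x‖ ^ 2 ≤ (μ / 4 - ρ) / 2 * ‖x₁ - x‖ ^ 2 := by
      exact mul_le_mul_of_nonneg_right (by linarith) (sq_nonneg _)
    have h11 := mul_le_mul_of_nonneg_left h7 hμ.le
    have h12 := mul_nonneg hμ.le (sq_nonneg (‖x' - x‖ - 2 * D))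
    have h13 := mul_nonneg hμ.le (sq_nonneg (‖x₁ - x‖ - D))
    rw [h8, h6] at h3
    nlinarith
  -- 475 hA + 57 hB: the gap coefficient is 475 + 3 · 57 = 646, and the D² terms cancel because 171
  -- ≤ 475.
  nlinarith

theorem lyapunov_nonneg (z : E × F) (hz : z.2 ∈ Y) :
    0 ≤ lyapunov Y f (μ / 4) xstar z := by
  have h1 := h.isMin z.1
  have h2 := h.dualityGap_nonneg (γ := μ / 4) (by linarith [h.mu_pos, h.rho_le]) z.1 z.1 hz
  rw [lyapunov]; linarith

/-- If the proximal gap after an epoch is bounded by the distances to the best responses plus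
`r`, the Lyapunov function contracts up to a multiple of `r`. -/
theorem lyapunov_contraction (x₀ x₁ : E) {y₀ y₁ : F} (hy₀ : y₀ ∈ Y) (hy₁ : y₁ ∈ Y) {a r : ℝ}
    (ham : 512 * a ≤ min (μ / 8) μy)
    (hgap : ∀ x, ∀ y ∈ Y,
      proximal f (μ / 4) x₀ x₁ y - proximal f (μ / 4) x₀ x y₁ ≤
        a * (‖x - x₀‖ ^ 2 + ‖y - y₀‖ ^ 2) + r) :
    lyapunov Y f (μ / 4) xstar (x₁, y₁) ≤
      1 / 2 * lyapunov Y f (μ / 4) xstar (x₀, y₀) + 82688 / 127 * r := by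
  have hμ := h.mu_pos
  have hρ := h.rho_le
  have hγ : ρ < μ / 4 := by linarith
  obtain ⟨x, y, hy, he, hd⟩ := h.exists_dualityGap_eq_dist_le (m := min (μ / 8) μy) hγ
    (by linarith) (le_min (by linarith) h.muy_pos.le) ((min_le_left _ _).trans (by linarith))
    (min_le_right _ _) x₀ x₀ x₁ hy₀ hy₁
  have h1 := hgap x y hy
  rw [← he] at h1
  have h2 := h.lyapunov_le x₀ x₁ hy₁
  have h3 := h.dualityGap_nonneg hγ x₀ x₀ hy₀
  have h4 := h.isMin x₀
  -- With this, the new gap is at most (old gap + new gap)/128 + r, that is old gap/127 + 128r/127.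
  -- Then 646/127 < 57/2 and 646 · 128 = 82688.
  have h5 : 128 * (a * (‖x - x₀‖ ^ 2 + ‖y - y₀‖ ^ 2)) ≤
      min (μ / 8) μy / 4 * (‖x - x₀‖ ^ 2 + ‖y - y₀‖ ^ 2) := by
    rw [← mul_assoc]; gcongr; linarith
  have h6 : lyapunov Y f (μ / 4) xstar (x₀, y₀) = 475 * (primal Y f x₀ - primal Y f xstar)
    + 57 * dualityGap Y (proximal f (μ / 4) x₀) x₀ y₀ := rfl
  rw [h6]
  linarith

/-- Both P(x₀) - P* and the proximal gap centred at x₀ are dominated by the gap of f, whence 475 +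
57 = 532. `hbdd` is essential, as `sInf` of a set unbounded below is 0 by convention. -/
theorem lyapunov_start_le {x₀ : E} {y₀ : F} (hy₀ : y₀ ∈ Y)
    (hbdd : BddBelow (range fun x => f x y₀)) :
    lyapunov Y f (μ / 4) xstar (x₀, y₀) ≤ 532 * dualityGap Y f x₀ y₀ := by
  have hμ := h.mu_pos
  have hρ := h.rho_le
  have hγ : ρ < μ / 4 := by linarith
  obtain ⟨x, y, hy, he, hp, -⟩ := h.exists_dualityGap_eq hγ x₀ x₀ hy₀
  have h1 : dualityGap Y f x₀ y₀ = primal Y f x₀ - sInf (range fun x => f x y₀) := rfl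
  have h2 : sInf (range fun x => f x y₀) ≤ f xstar y₀ := csInf_le hbdd (mem_range_self _)
  have h3 : sInf (range fun x => f x y₀) ≤ f x y₀ := csInf_le hbdd (mem_range_self _)
  have h4 := h.le_primal xstar hy₀
  have h5 : 0 ≤ μ / 4 / 2 * ‖x - x₀‖ ^ 2 := by positivity
  rw [lyapunov]
  simp only
  rw [he, h1, hp]
  simp only [proximal, sub_self, norm_zero]
  rw [hp] at *
  linarith

end SaddleProblem

end

/-! ### The proximal step in closed form. -/

section Prox

variable {E F : Type*} [NormedAddCommGroup E] [InnerProductSpace ℝ E]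
  [NormedAddCommGroup F] [InnerProductSpace ℝ F]

/-- `π` is the metric projection onto `Y`, given by its variational inequality. -/
structure IsProjection (Y : Set F) (π : F → F) : Prop where
  mem : ∀ u, π u ∈ Y
  inner_nonpos : ∀ u, ∀ w ∈ Y, inner ℝ (u - π u) (w - π u) ≤ 0

theorem exists_isProjection [CompleteSpace F] {Y : Set F} (hne : Y.Nonempty) (hc : IsClosed Y)
    (hconv : Convex ℝ Y) : ∃ π : F → F, IsProjection Y π := by
  have : ∀ u : F, ∃ v ∈ Y, ∀ w ∈ Y, inner ℝ (u - v) (w - v) ≤ 0 := fun u => by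
    obtain ⟨v, hv, he⟩ := exists_norm_eq_iInf_of_complete_convex hne hc.isComplete hconv u
    exact ⟨v, hv, (norm_eq_iInf_iff_real_inner_le_zero hconv hv).1 he⟩
  choose π h1 h2 using this
  exact ⟨π, h1, h2⟩

theorem IsProjection.norm_sub_le {Y : Set F} {π : F → F} (h : IsProjection Y π) (u v : F) :
    ‖π u - π v‖ ≤ ‖u - v‖ := by
  have h1 := h.inner_nonpos u (π v) (h.mem v)
  have h2 := h.inner_nonpos v (π u) (h.mem u)
  have h3 : inner ℝ (u - π u) (π v - π u) + inner ℝ (v - π v) (π u - π v) =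
      ‖π u - π v‖ ^ 2 - inner ℝ (u - v) (π u - π v) := by
    rw [← real_inner_self_eq_norm_sq]
    simp only [inner_sub_left, inner_sub_right]
    ring
  have h4 := real_inner_le_norm (u - v) (π u - π v)
  by_contra hcon
  push Not at hcon
  nlinarith [norm_nonneg (u - v), norm_nonneg (π u - π v)]

theorem IsProjection.continuous {Y : Set F} {π : F → F} (h : IsProjection Y π) :
    Continuous π :=
  (LipschitzWith.of_dist_le_mul (K := 1) fun u v => by
    simpa [dist_eq_norm] using h.norm_sub_le u v).continuous

theorem IsProjection.eq_self {Y : Set F} {π : F → F} (h : IsProjection Y π) {u : F} (hu : u ∈ Y) :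
    π u = u := by
  have := h.inner_nonpos u u hu
  rw [real_inner_self_eq_norm_sq] at this
  have h2 : ‖u - π u‖ = 0 := by nlinarith [sq_nonneg ‖u - π u‖]
  exact (sub_eq_zero.1 (norm_eq_zero.1 h2)).symm

/-- Completing the square; the minimization over x is unconstrained, so the three-point inequality
is an identity. -/
theorem quadratic_prox_eq {c : ℝ} (hc : 0 ≤ c) (x₀ zbar v w : E) :
    let p := (1 + c)⁻¹ • (zbar - v + c • x₀)
    inner ℝ v w + 1 / 2 * ‖w - zbar‖ ^ 2 + c / 2 * ‖w - x₀‖ ^ 2 =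
      inner ℝ v p + 1 / 2 * ‖p - zbar‖ ^ 2 + c / 2 * ‖p - x₀‖ ^ 2
        + (1 + c) / 2 * ‖w - p‖ ^ 2 := by
  intro p
  have hp : v = zbar + c • x₀ - (1 + c) • p := by
    simp only [p]
    rw [smul_inv_smul₀ (by linarith)]
    abel
  rw [hp]
  simp only [← real_inner_self_eq_norm_sq, inner_sub_left, inner_sub_right, inner_add_left,
    real_inner_smul_left]
  rw [real_inner_comm w zbar, real_inner_comm w x₀, real_inner_comm p zbar, real_inner_comm p x₀,
    real_inner_comm w p]
  ring

/-- The regularization only shrinks the displacement from `x₀`; this propagates square integrability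
along the iterates. -/
theorem norm_prox_sub_le {c : ℝ} (hc : 0 ≤ c) (x₀ x v : E) :
    ‖(1 + c)⁻¹ • (x - v + c • x₀) - x₀‖ ≤ ‖x - x₀ - v‖ := by
  have h0 : (1 + c) ≠ 0 := by linarith
  have e : (1 + c)⁻¹ • (x - v + c • x₀) - x₀ = (1 + c)⁻¹ • (x - x₀ - v) := by
    have e' : x₀ = (1 + c)⁻¹ • (1 + c) • x₀ := (inv_smul_smul₀ h0 x₀).symm
    nth_rewrite 2 [e']
    rw [← smul_sub]
    congr 1
    module
  rw [e, norm_smul, Real.norm_of_nonneg (by positivity)]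
  exact mul_le_of_le_one_left (norm_nonneg _) (inv_le_one_of_one_le₀ (by linarith))

theorem IsProjection.prox_le {Y : Set F} {π : F → F} (h : IsProjection Y π) (zbar v : F) {w : F}
    (hw : w ∈ Y) :
    let p := π (zbar - v)
    inner ℝ v p + 1 / 2 * ‖p - zbar‖ ^ 2 + 1 / 2 * ‖w - p‖ ^ 2 ≤
      inner ℝ v w + 1 / 2 * ‖w - zbar‖ ^ 2 := by
  intro p
  have h1 := h.inner_nonpos (zbar - v) w hw
  change inner ℝ (zbar - v - p) (w - p) ≤ 0 at h1
  simp only [inner_sub_left, inner_sub_right] at h1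
  simp only [← real_inner_self_eq_norm_sq, inner_sub_left, inner_sub_right]
  rw [real_inner_comm w zbar, real_inner_comm p zbar, real_inner_comm w p] at *
  linarith

/-- Quadratic growth around the explicit point makes the minimizer unique, so the arbitrary choice
in `argminOn` must be that point. -/
theorem proxStep_eq {Y : Set F} {π : F → F} (h : IsProjection Y π) {c : ℝ} (hc : 0 ≤ c) (x₀ : E)
    (zbar v : E × F) :
    proxStep Y c x₀ zbar v =
      ((1 + c)⁻¹ • (zbar.1 - v.1 + c • x₀), π (zbar.2 - v.2)) := by
  set p : E × F := ((1 + c)⁻¹ • (zbar.1 - v.1 + c • x₀), π (zbar.2 - v.2)) with hp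
  set φ : E × F → ℝ := fun z => inner ℝ v.1 z.1 + inner ℝ v.2 z.2
      + 1 / 2 * (‖z.1 - zbar.1‖ ^ 2 + ‖z.2 - zbar.2‖ ^ 2) + c / 2 * ‖z.1 - x₀‖ ^ 2 with hφ
  have key : ∀ w ∈ {z : E × F | z.2 ∈ Y},
      φ p + (1 / 2 * ‖w.1 - p.1‖ ^ 2 + 1 / 2 * ‖w.2 - p.2‖ ^ 2) ≤ φ w := by
    intro w hw
    have h1 := quadratic_prox_eq hc x₀ zbar.1 v.1 w.1
    have h2 := h.prox_le zbar.2 v.2 hw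
    simp only at h1 h2
    have h3 := mul_nonneg hc (sq_nonneg ‖w.1 - p.1‖)
    simp only [hφ, hp] at h3 ⊢
    linarith
  have hpY : p ∈ {z : E × F | z.2 ∈ Y} := h.mem _
  have hex : ∃ z, z ∈ {z : E × F | z.2 ∈ Y} ∧ ∀ w ∈ {z : E × F | z.2 ∈ Y}, φ z ≤ φ w :=
    ⟨p, hpY, fun w hw => by
      have := key w hw
      have : 0 ≤ 1 / 2 * ‖w.1 - p.1‖ ^ 2 + 1 / 2 * ‖w.2 - p.2‖ ^ 2 := by positivity
      linarith⟩
  have hdef : proxStep Y c x₀ zbar v = hex.choose := by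
    rw [proxStep, argminOn, dif_pos hex]
  rw [hdef]
  have hs := hex.choose_spec
  have h1 := key _ hs.1
  have h2 := hs.2 p hpY
  set q := hex.choose
  have h3 := sq_nonneg ‖q.1 - p.1‖
  have h4 := sq_nonneg ‖q.2 - p.2‖
  have h5 : ‖q.1 - p.1‖ = 0 := pow_eq_zero_iff (two_ne_zero) |>.1 (by linarith)
  have h6 : ‖q.2 - p.2‖ = 0 := pow_eq_zero_iff (two_ne_zero) |>.1 (by linarith)
  exact Prod.ext (sub_eq_zero.1 (norm_eq_zero.1 h5)) (sub_eq_zero.1 (norm_eq_zero.1 h6))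

end Prox

/-! ### Pathwise regret of stochastic proximal steps. -/

section Pathwise

variable {H : Type*} [NormedAddCommGroup H] [InnerProductSpace ℝ H]

/-- The error of `T` stochastic proximal steps `u` of size `η` along `v`, where `v t` estimates
`g t` and the second moments are at most `B ^ 2`. -/
noncomputable def noise (η B : ℝ) (T : ℕ) (u v g : ℕ → H) : ℝ :=
  η * B ^ 2 + η / 2 * ∑ t ∈ Finset.range T, ‖v t‖ ^ 2
    + η / 2 * ‖∑ t ∈ Finset.range T, (v t - g t)‖ ^ 2
    - ∑ t ∈ Finset.range T, inner ℝ (v t - g t) (u t - u 0)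

theorem inner_le_div_add_mul {η : ℝ} (hη : 0 < η) (a b : H) :
    inner ℝ a b ≤ 1 / (2 * η) * ‖b‖ ^ 2 + η / 2 * ‖a‖ ^ 2 := by
  have h1 : 0 ≤ 1 / (2 * η) * (‖b‖ - η * ‖a‖) ^ 2 := by positivity
  have h2 : 1 / (2 * η) * (‖b‖ - η * ‖a‖) ^ 2 =
      1 / (2 * η) * ‖b‖ ^ 2 + η / 2 * ‖a‖ ^ 2 - ‖a‖ * ‖b‖ := by field_simp; ring
  linarith [real_inner_le_norm a b]

/-- The comparator `w` may depend on all samples, so it is removed from the error term before any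
expectation. The coefficient 3/(2η) has three equal parts: the telescoped distance, Young's
inequality for the accumulated error, and the boundary term at 0. -/
theorem sum_inner_le_noise {η τ B : ℝ} (hη : 0 < η) (T : ℕ) (u v g : ℕ → H) (w : H)
    (hstep : ∀ t < T, inner ℝ (η • v t) (u (t + 1)) + 1 / 2 * ‖u (t + 1) - u t‖ ^ 2
        + τ * η / 2 * ‖u (t + 1) - u 0‖ ^ 2 + (1 + τ * η) / 2 * ‖w - u (t + 1)‖ ^ 2 ≤
      inner ℝ (η • v t) w + 1 / 2 * ‖w - u t‖ ^ 2 + τ * η / 2 * ‖w - u 0‖ ^ 2)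
    (h0 : ‖g 0‖ ^ 2 ≤ B ^ 2) (hT : ‖g T‖ ^ 2 ≤ B ^ 2) :
    ∑ t ∈ Finset.range T, (inner ℝ (g (t + 1)) (u (t + 1) - w) + τ / 2 * ‖u (t + 1) - u 0‖ ^ 2
        - τ / 2 * ‖w - u 0‖ ^ 2 + τ / 2 * ‖w - u (t + 1)‖ ^ 2) ≤
      3 / (2 * η) * ‖w - u 0‖ ^ 2 + noise η B T u v g := by
  have step : ∀ t < T, inner ℝ (v t) (u t - w) + (τ / 2 * ‖u (t + 1) - u 0‖ ^ 2
        - τ / 2 * ‖w - u 0‖ ^ 2 + τ / 2 * ‖w - u (t + 1)‖ ^ 2) ≤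
      1 / (2 * η) * (‖w - u t‖ ^ 2 - ‖w - u (t + 1)‖ ^ 2) + η / 2 * ‖v t‖ ^ 2 := by
    intro t ht
    have h1 := hstep t ht
    rw [real_inner_smul_left, real_inner_smul_left] at h1
    have h2 := inner_le_div_add_mul hη (v t) (u t - u (t + 1))
    have h3 : inner ℝ (v t) (u t - w) = inner ℝ (v t) (u t - u (t + 1))
        + (inner ℝ (v t) (u (t + 1)) - inner ℝ (v t) w) := by
      simp only [inner_sub_right]; ring
    rw [norm_sub_rev (u t)] at h2
    rw [h3]
    have h4 : η * (inner ℝ (v t) (u (t + 1)) - inner ℝ (v t) w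
          + (τ / 2 * ‖u (t + 1) - u 0‖ ^ 2 - τ / 2 * ‖w - u 0‖ ^ 2 + τ / 2 * ‖w - u (t + 1)‖ ^ 2))
        ≤ η * (1 / (2 * η) * (‖w - u t‖ ^ 2 - ‖w - u (t + 1)‖ ^ 2)
          - 1 / (2 * η) * ‖u (t + 1) - u t‖ ^ 2) := by
      have e : ∀ a b : ℝ, η * (1 / (2 * η) * a - 1 / (2 * η) * b) = 1 / 2 * a - 1 / 2 * b := by
        intro a b; field_simp
      rw [e]
      linarith
    have h5 := le_of_mul_le_mul_left h4 hη
    linarith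
  have hsum : ∑ t ∈ Finset.range T, (inner ℝ (v t) (u t - w) + (τ / 2 * ‖u (t + 1) - u 0‖ ^ 2
        - τ / 2 * ‖w - u 0‖ ^ 2 + τ / 2 * ‖w - u (t + 1)‖ ^ 2)) ≤
      1 / (2 * η) * (‖w - u 0‖ ^ 2 - ‖w - u T‖ ^ 2)
        + η / 2 * ∑ t ∈ Finset.range T, ‖v t‖ ^ 2 := by
    refine (Finset.sum_le_sum fun t ht => step t (Finset.mem_range.1 ht)).trans_eq ?_
    rw [Finset.sum_add_distrib, ← Finset.mul_sum, ← Finset.mul_sum,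
      Finset.sum_range_sub' (fun t => ‖w - u t‖ ^ 2)]
  -- The averaged iterates are 1, …, T but the steps use gradients at 0, …, T - 1. The shift leaves
  -- two boundary terms, which is why the gradient bound is needed at T as well.
  have hshift : ∑ t ∈ Finset.range T, inner ℝ (g (t + 1)) (u (t + 1) - w) =
      ∑ t ∈ Finset.range T, inner ℝ (g t) (u t - w) + inner ℝ (g T) (u T - w)
        - inner ℝ (g 0) (u 0 - w) := by
    have := Finset.sum_range_succ' (fun t => (inner ℝ (g t) (u t - w) : ℝ)) T
    rw [Finset.sum_range_succ] at this
    linarith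
  have hnoise : ∑ t ∈ Finset.range T, inner ℝ (g t) (u t - w) =
      ∑ t ∈ Finset.range T, inner ℝ (v t) (u t - w)
        - ∑ t ∈ Finset.range T, inner ℝ (v t - g t) (u t - u 0)
        + inner ℝ (∑ t ∈ Finset.range T, (v t - g t)) (w - u 0) := by
    rw [sum_inner, ← Finset.sum_sub_distrib, ← Finset.sum_add_distrib]
    refine Finset.sum_congr rfl fun t _ => ?_
    simp only [inner_sub_left, inner_sub_right]; ring
  have b1 := inner_le_div_add_mul hη (∑ t ∈ Finset.range T, (v t - g t)) (w - u 0)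
  -- The boundary term at T is absorbed by the negative distance `‖w - u T‖²` left over from
  -- telescoping.
  have b2 := inner_le_div_add_mul hη (g T) (u T - w)
  have b3 := inner_le_div_add_mul hη (g 0) (w - u 0)
  have b4 : inner ℝ (g 0) (w - u 0) = - inner ℝ (g 0) (u 0 - w) := by
    rw [← inner_neg_right, neg_sub]
  rw [norm_sub_rev (u T)] at b2
  have b5 := mul_le_mul_of_nonneg_left h0 (half_pos hη).le
  have b6 := mul_le_mul_of_nonneg_left hT (half_pos hη).le
  have e3 : 3 / (2 * η) * ‖w - u 0‖ ^ 2 = 3 * (1 / (2 * η) * ‖w - u 0‖ ^ 2) := by ring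
  have hsplit : ∑ t ∈ Finset.range T, (inner ℝ (g (t + 1)) (u (t + 1) - w)
        + τ / 2 * ‖u (t + 1) - u 0‖ ^ 2
        - τ / 2 * ‖w - u 0‖ ^ 2 + τ / 2 * ‖w - u (t + 1)‖ ^ 2) =
      ∑ t ∈ Finset.range T, inner ℝ (g (t + 1)) (u (t + 1) - w)
        + ∑ t ∈ Finset.range T, (τ / 2 * ‖u (t + 1) - u 0‖ ^ 2
        - τ / 2 * ‖w - u 0‖ ^ 2 + τ / 2 * ‖w - u (t + 1)‖ ^ 2) := by
    rw [← Finset.sum_add_distrib]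
    exact Finset.sum_congr rfl fun t _ => by ring
  rw [Finset.sum_add_distrib] at hsum
  rw [hsplit, hshift, hnoise, noise, e3]
  rw [mul_sub] at hsum
  linarith

end Pathwise

/-! ### One epoch, sample by sample. -/

section Epoch

variable {E F S : Type*} [NormedAddCommGroup E] [InnerProductSpace ℝ E]
  [NormedAddCommGroup F] [InnerProductSpace ℝ F] {Y : Set F}

theorem sgdaAverage_eq (Gx : E → F → S → E) (Gy : E → F → S → F) (γ η : ℝ) (T : ℕ) (z₀ : E × F)
    (s : ℕ → S) : sgdaAverage Y Gx Gy γ η T z₀ s =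
      (T : ℝ)⁻¹ • ∑ t ∈ Finset.range T, sgda Y Gx Gy γ η z₀ s (t + 1) := by
  rw [sgdaAverage, Finset.range_eq_Ico, Finset.sum_Ico_add' (fun t => sgda Y Gx Gy γ η z₀ s t)]
  rfl

theorem sgda_mem [CompleteSpace F] (hne : Y.Nonempty) (hcl : IsClosed Y) (hconv : Convex ℝ Y)
    (Gx : E → F → S → E) (Gy : E → F → S → F) {γ η : ℝ} (hγη : 0 ≤ γ * η) (z₀ : E × F)
    (hz₀ : z₀.2 ∈ Y) (s : ℕ → S) (t : ℕ) : (sgda Y Gx Gy γ η z₀ s t).2 ∈ Y := by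
  obtain ⟨π, hπ⟩ := exists_isProjection hne hcl hconv
  cases t with
  | zero => exact hz₀
  | succ t => rw [sgda, proxStep_eq hπ hγη]; exact hπ.mem _

theorem sgdaAverage_mem [CompleteSpace F] (hne : Y.Nonempty) (hcl : IsClosed Y) (hconv : Convex ℝ Y)
    (Gx : E → F → S → E) (Gy : E → F → S → F) {γ η : ℝ} (hγη : 0 ≤ γ * η) {T : ℕ} (hT : 0 < T)
    (z₀ : E × F) (hz₀ : z₀.2 ∈ Y) (s : ℕ → S) : (sgdaAverage Y Gx Gy γ η T z₀ s).2 ∈ Y := by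
  have hT' : (T : ℝ) ≠ 0 := by positivity
  rw [sgdaAverage_eq, Prod.smul_snd, Prod.snd_sum, Finset.smul_sum]
  exact hconv.sum_mem (fun _ _ => by positivity) (by simp [hT'])
    (fun t _ => sgda_mem hne hcl hconv Gx Gy hγη z₀ hz₀ s _)

variable [ProperSpace E] [ProperSpace F]
  {f : E → F → ℝ} {gx : E → F → E} {gy : E → F → F} {μ μy ρ : ℝ} {xstar : E}

/-- Jensen's inequality for the proximal gap of an average. -/
theorem SaddleProblem.mul_gap_le_sum (h : SaddleProblem Y f gx gy μ μy ρ xstar) {γ : ℝ}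
    (hγ : ρ ≤ γ) (c x : E) {y : F} (hy : y ∈ Y) {T : ℕ} (hT : 0 < T) (z : ℕ → E × F)
    (hz : ∀ t, (z t).2 ∈ Y) :
    let a := (T : ℝ)⁻¹ • ∑ t ∈ Finset.range T, z t
    T * (proximal f γ c a.1 y - proximal f γ c x a.2) ≤
      ∑ t ∈ Finset.range T, (proximal f γ c (z t).1 y - proximal f γ c x (z t).2) := by
  intro a
  have hT' : (T : ℝ) ≠ 0 := by positivity
  have haY : a.2 ∈ Y := by
    simp only [a]
    rw [Prod.smul_snd, Prod.snd_sum, Finset.smul_sum]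
    exact h.convex.sum_mem (fun _ _ => by positivity) (by simp [hT']) (fun t _ => hz t)
  have ha : (T : ℝ) • a = ∑ t ∈ Finset.range T, z t := by simp only [a]; rw [smul_inv_smul₀ hT']
  have h1 : ∑ t ∈ Finset.range T, ((z t).1 - a.1) = 0 := by
    rw [Finset.sum_sub_distrib, ← Prod.fst_sum, ← ha]
    simp [← Nat.cast_smul_eq_nsmul ℝ]
  have h2 : ∑ t ∈ Finset.range T, ((z t).2 - a.2) = 0 := by
    rw [Finset.sum_sub_distrib, ← Prod.snd_sum, ← ha]
    simp [← Nat.cast_smul_eq_nsmul ℝ]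
  have h3 : ∀ t ∈ Finset.range T,
      (proximal f γ c a.1 y - proximal f γ c x a.2)
        + (inner ℝ (gx a.1 y + γ • (a.1 - c)) ((z t).1 - a.1)
        - inner ℝ (gy x a.2) ((z t).2 - a.2)) ≤
      proximal f γ c (z t).1 y - proximal f γ c x (z t).2 := by
    intro t _
    have e1 := h.le_proximal γ c hy (z t).1 a.1
    have e2 := (h.strongConcave x).le_add_inner (h.grad x a.2 haY).2 haY (hz t)
    have e3 : 0 ≤ (γ - ρ) / 2 * ‖(z t).1 - a.1‖ ^ 2 := mul_nonneg (by linarith) (sq_nonneg _)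
    have e4 : 0 ≤ μy / 2 * ‖(z t).2 - a.2‖ ^ 2 := by have := h.muy_pos; positivity
    have e5 : proximal f γ c x (z t).2 - proximal f γ c x a.2 = f x (z t).2 - f x a.2 := by
      simp only [proximal]; ring
    linarith
  have h4 := Finset.sum_le_sum h3
  rw [Finset.sum_add_distrib, Finset.sum_const, Finset.sum_sub_distrib, ← inner_sum, ← inner_sum,
    h1, h2] at h4
  simpa using h4

theorem SaddleProblem.epoch_gap_le (h : SaddleProblem Y f gx gy μ μy ρ xstar)
    (Gx : E → F → S → E) (Gy : E → F → S → F) {γ η B : ℝ} (hγ : ρ ≤ γ) (hγ0 : 0 ≤ γ)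
    (hη : 0 < η) {T : ℕ} (hT : 0 < T) (z₀ : E × F) (hz₀ : z₀.2 ∈ Y) (s : ℕ → S)
    (hB : ∀ t ≤ T, let z := sgda Y Gx Gy γ η z₀ s t
      ‖gx z.1 z.2‖ ^ 2 ≤ B ^ 2 ∧ ‖gy z.1 z.2‖ ^ 2 ≤ B ^ 2)
    (x : E) {y : F} (hy : y ∈ Y) :
    let z := sgda Y Gx Gy γ η z₀ s
    let a := sgdaAverage Y Gx Gy γ η T z₀ s
    T * (proximal f γ z₀.1 a.1 y - proximal f γ z₀.1 x a.2) ≤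
      3 / (2 * η) * (‖x - z₀.1‖ ^ 2 + ‖y - z₀.2‖ ^ 2)
        + (noise η B T (fun t => (z t).1) (fun t => Gx (z t).1 (z t).2 (s t))
            (fun t => gx (z t).1 (z t).2)
          + noise η B T (fun t => (z t).2) (fun t => -Gy (z t).1 (z t).2 (s t))
            (fun t => -gy (z t).1 (z t).2)) := by
  intro z a
  have hγη : 0 ≤ γ * η := by positivity
  obtain ⟨π, hπ⟩ := exists_isProjection h.nonempty h.isClosed h.convex
  have hzY : ∀ t, (z t).2 ∈ Y := sgda_mem h.nonempty h.isClosed h.convex Gx Gy hγη z₀ hz₀ s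
  have hz : ∀ t, z (t + 1) = proxStep Y (γ * η) z₀.1 (z t)
      (η • Gx (z t).1 (z t).2 (s t), -(η • Gy (z t).1 (z t).2 (s t))) := fun t => rfl
  have hx := sum_inner_le_noise (τ := γ) (B := B) hη T (fun t => (z t).1)
    (fun t => Gx (z t).1 (z t).2 (s t)) (fun t => gx (z t).1 (z t).2) x (fun t _ => by
      have := quadratic_prox_eq hγη z₀.1 (z t).1 (η • Gx (z t).1 (z t).2 (s t)) x
      have e : (z (t + 1)).1 = (1 + γ * η)⁻¹ • ((z t).1 - η • Gx (z t).1 (z t).2 (s t)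
        + (γ * η) • z₀.1) := by rw [hz, proxStep_eq hπ hγη]
      simp only at this
      rw [← e] at this
      exact this.ge) (hB 0 (Nat.zero_le _)).1 (hB T le_rfl).1
  have hyy := sum_inner_le_noise (τ := 0) (B := B) hη T (fun t => (z t).2)
    (fun t => -Gy (z t).1 (z t).2 (s t)) (fun t => -gy (z t).1 (z t).2) y (fun t _ => by
      have := hπ.prox_le (z t).2 (-(η • Gy (z t).1 (z t).2 (s t))) hy
      have e : (z (t + 1)).2 = π ((z t).2 - -(η • Gy (z t).1 (z t).2 (s t))) := by
        rw [hz, proxStep_eq hπ hγη]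
      simp only at this
      rw [← e] at this
      simp only [smul_neg]
      linarith) (by simpa using (hB 0 (Nat.zero_le _)).2) (by simpa using (hB T le_rfl).2)
  have hj := h.mul_gap_le_sum hγ z₀.1 x hy hT (fun t => z (t + 1)) (fun t => hzY _)
  have ha : a = (T : ℝ)⁻¹ • ∑ t ∈ Finset.range T, z (t + 1) := sgdaAverage_eq _ _ _ _ _ _ _
  simp only at hj
  rw [← ha] at hj
  refine hj.trans ?_
  have hle := Finset.sum_le_sum (s := Finset.range T)
    (f := fun t => proximal f γ z₀.1 (z (t + 1)).1 y - proximal f γ z₀.1 x (z (t + 1)).2)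
    (g := fun t => (inner ℝ (gx (z (t + 1)).1 (z (t + 1)).2) ((z (t + 1)).1 - x)
        + γ / 2 * ‖(z (t + 1)).1 - (z 0).1‖ ^ 2
        - γ / 2 * ‖x - (z 0).1‖ ^ 2 + γ / 2 * ‖x - (z (t + 1)).1‖ ^ 2)
      + (inner ℝ (-gy (z (t + 1)).1 (z (t + 1)).2) ((z (t + 1)).2 - y)
        + 0 / 2 * ‖(z (t + 1)).2 - (z 0).2‖ ^ 2
        - 0 / 2 * ‖y - (z 0).2‖ ^ 2 + 0 / 2 * ‖y - (z (t + 1)).2‖ ^ 2)) (fun t _ => by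
      have e1 := h.weaklyConvex _ (hzY (t + 1)) x (z (t + 1)).1
      have e2 := (h.strongConcave (z (t + 1)).1).le_add_inner
        (h.grad _ _ (hzY (t + 1))).2 (hzY (t + 1)) hy
      -- The implicit treatment of the regularizer supplies this γ-term, which compensates for the
      -- defect of convexity.
      have e3 : ρ / 2 * ‖x - (z (t + 1)).1‖ ^ 2 ≤ γ / 2 * ‖x - (z (t + 1)).1‖ ^ 2 := by gcongr
      have e4 : 0 ≤ μy / 2 * ‖y - (z (t + 1)).2‖ ^ 2 := by have := h.muy_pos; positivity
      have e5 : ∀ q : E, inner ℝ q ((z (t + 1)).1 - x) = - inner ℝ q (x - (z (t + 1)).1) := by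
        intro q; rw [← inner_neg_right, neg_sub]
      have e6 : inner ℝ (-gy (z (t + 1)).1 (z (t + 1)).2) ((z (t + 1)).2 - y)
          = inner ℝ (gy (z (t + 1)).1 (z (t + 1)).2) (y - (z (t + 1)).2) := by
        rw [← inner_neg_neg, neg_neg, neg_sub]
      have e7 : (z 0).1 = z₀.1 := rfl
      simp only [proximal, e5, e6, e7] at *
      linarith)
  rw [Finset.sum_add_distrib] at hle
  refine hle.trans ?_
  have e7 : z 0 = z₀ := rfl
  rw [e7] at hx hyy ⊢
  linarith

/-- One epoch of SGDA contracts the Lyapunov function up to the noise. -/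
theorem SaddleProblem.lyapunov_sgdaAverage_le (h : SaddleProblem Y f gx gy μ μy ρ xstar)
    (Gx : E → F → S → E) (Gy : E → F → S → F) {η B : ℝ}
    (hη : 0 < η) {T : ℕ} (hT : 0 < T) (hηT : 768 ≤ η * T * min (μ / 8) μy)
    (z₀ : E × F) (hz₀ : z₀.2 ∈ Y) (s : ℕ → S)
    (hB : ∀ t ≤ T, let z := sgda Y Gx Gy (μ / 4) η z₀ s t
      ‖gx z.1 z.2‖ ^ 2 ≤ B ^ 2 ∧ ‖gy z.1 z.2‖ ^ 2 ≤ B ^ 2) :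
    let z := sgda Y Gx Gy (μ / 4) η z₀ s
    lyapunov Y f (μ / 4) xstar (sgdaAverage Y Gx Gy (μ / 4) η T z₀ s) ≤
      1 / 2 * lyapunov Y f (μ / 4) xstar z₀ + 82688 / 127 * ((T : ℝ)⁻¹ *
        (noise η B T (fun t => (z t).1) (fun t => Gx (z t).1 (z t).2 (s t))
            (fun t => gx (z t).1 (z t).2)
          + noise η B T (fun t => (z t).2) (fun t => -Gy (z t).1 (z t).2 (s t))
            (fun t => -gy (z t).1 (z t).2))) := by
  intro z
  have hμ := h.mu_pos
  have hρ := h.rho_le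
  have hT' : (0 : ℝ) < T := by positivity
  have hmem := sgdaAverage_mem h.nonempty h.isClosed h.convex Gx Gy
    (show 0 ≤ μ / 4 * η by positivity) hT z₀ hz₀ s
  refine h.lyapunov_contraction z₀.1 _ hz₀ hmem (a := (T : ℝ)⁻¹ * (3 / (2 * η))) ?_ ?_
  -- Here a = 3/(2ηT), so 512 a ≤ min(μ/8, μ_y) is the condition with 768 = 512 · 3/2.
  · rw [← div_eq_inv_mul, div_div, mul_div_assoc', div_le_iff₀ (by positivity)]
    linarith
  · intro x y hy
    have := h.epoch_gap_le Gx Gy (γ := μ / 4) (by linarith) (by linarith) hη hT z₀ hz₀ s hB x hy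
    simp only at this
    rw [mul_assoc, ← mul_add, ← div_eq_inv_mul, le_div_iff₀ hT', mul_comm _ (T : ℝ)]
    exact this

end Epoch

/-! ### Moments of the oracle at random query points. -/

theorem integrable_inner_of_memLp {Ω H : Type*} [MeasurableSpace Ω] {Pr : Measure Ω}
    [NormedAddCommGroup H] [InnerProductSpace ℝ H] {a b : Ω → H} (ha : MemLp a 2 Pr)
    (hb : MemLp b 2 Pr) : Integrable (fun ω => inner ℝ (a ω) (b ω)) Pr :=
  (ha.norm.integrable_mul hb.norm).mono' (ha.1.inner hb.1)
    (ae_of_all _ fun ω => norm_inner_le_norm (𝕜 := ℝ) (a ω) (b ω))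

/-- The mean of a square integrable random vector, and the variance, are controlled by the second
moment. -/
theorem mean_and_variance_le {S H : Type*} [MeasurableSpace S] {ν : Measure S}
    [IsProbabilityMeasure ν] [NormedAddCommGroup H] [InnerProductSpace ℝ H] [CompleteSpace H] {V : S → H} {B : ℝ} (hV : Integrable V ν)
    (hV2 : Integrable (fun s => ‖V s‖ ^ 2) ν) (hB : ∫ s, ‖V s‖ ^ 2 ∂ν ≤ B ^ 2) :
    ‖∫ s, V s ∂ν‖ ^ 2 ≤ B ^ 2 ∧ Integrable (fun s => ‖V s - ∫ s, V s ∂ν‖ ^ 2) ν ∧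
      ∫ s, ‖V s - ∫ s, V s ∂ν‖ ^ 2 ∂ν ≤ B ^ 2 := by
  set c := ∫ s, V s ∂ν with hc
  have e : ∀ s, ‖V s - c‖ ^ 2 = ‖V s‖ ^ 2 - 2 * inner ℝ c (V s) + ‖c‖ ^ 2 := fun s => by
    rw [norm_sub_sq_real, real_inner_comm]
  have hi : Integrable (fun s => inner ℝ c (V s)) ν := hV.const_inner c
  have hI : ∫ s, inner ℝ c (V s) ∂ν = ‖c‖ ^ 2 := by
    rw [integral_inner hV, ← hc, real_inner_self_eq_norm_sq]
  have hs : Integrable (fun s => ‖V s‖ ^ 2 - 2 * inner ℝ c (V s)) ν := hV2.sub (hi.const_mul 2)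
  have h1 : Integrable (fun s => ‖V s - c‖ ^ 2) ν := by
    simp only [e]
    exact hs.add (integrable_const _)
  have h2 : ∫ s, ‖V s - c‖ ^ 2 ∂ν = ∫ s, ‖V s‖ ^ 2 ∂ν - ‖c‖ ^ 2 := by
    simp only [e]
    rw [integral_add hs (integrable_const _),
      integral_sub hV2 (hi.const_mul 2), integral_const_mul, hI]
    simp
    ring
  have h3 : 0 ≤ ∫ s, ‖V s - c‖ ^ 2 ∂ν := integral_nonneg fun _ => sq_nonneg _
  exact ⟨by linarith, h1, by linarith [sq_nonneg ‖c‖]⟩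

section Oracle

variable {Ω S 𝒳 H : Type*} {m mΩ : MeasurableSpace Ω} [MeasurableSpace S] [MeasurableSpace 𝒳]
  {Pr : Measure Ω} [IsProbabilityMeasure Pr] {ν : Measure S}

theorem map_prodMk_of_indep (hm : m ≤ mΩ) {ξ : Ω → S} (hξ : Measurable ξ)
    (hind : Indep m (MeasurableSpace.comap ξ inferInstance) Pr) (hν : Pr.map ξ = ν) {X : Ω → 𝒳}
    (hX : Measurable[m] X) : Pr.map (fun ω => (X ω, ξ ω)) = (Pr.map X).prod ν := by
  have h1 : IndepFun X ξ Pr :=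
    (IndepFun_iff_Indep _ _ _).2 (indep_of_indep_of_le_left hind hX.comap_le)
  rw [← hν]
  exact (indepFun_iff_map_prod_eq_prod_map_map (hX.mono hm le_rfl).aemeasurable
    hξ.aemeasurable).1 h1

variable [IsProbabilityMeasure ν] [NormedAddCommGroup H] [ProperSpace H] [MeasurableSpace H] [BorelSpace H]

/-- Independence makes the law of (X, ξ) a product, so Fubini replaces conditional expectation. -/
theorem second_moment_le (hm : m ≤ mΩ) {ξ : Ω → S} (hξ : Measurable ξ)
    (hind : Indep m (MeasurableSpace.comap ξ inferInstance) Pr) (hν : Pr.map ξ = ν) {X : Ω → 𝒳}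
    (hX : Measurable[m] X) {V : 𝒳 × S → H} (hV : Measurable V) {B : ℝ}
    (hB : ∀ᵐ ω ∂Pr, Integrable (fun s => ‖V (X ω, s)‖ ^ 2) ν ∧
      ∫ s, ‖V (X ω, s)‖ ^ 2 ∂ν ≤ B ^ 2) :
    MemLp (fun ω => V (X ω, ξ ω)) 2 Pr ∧ ∫ ω, ‖V (X ω, ξ ω)‖ ^ 2 ∂Pr ≤ B ^ 2 := by
  have hXm : Measurable X := hX.mono hm le_rfl
  have hpair : Measurable fun ω => (X ω, ξ ω) := hXm.prodMk hξ
  have hmap := map_prodMk_of_indep hm hξ hind hν hX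
  have hV2 : Measurable fun p => ‖V p‖ ^ 2 := hV.norm.pow_const 2
  have hin : StronglyMeasurable fun x => ∫ s, ‖V (x, s)‖ ^ 2 ∂ν :=
    hV2.stronglyMeasurable.integral_prod_right'
  have hprob : IsProbabilityMeasure (Pr.map X) := Measure.isProbabilityMeasure_map hXm.aemeasurable
  have hset : MeasurableSet {x | Integrable (fun s => ‖V (x, s)‖ ^ 2) ν} :=
    measurableSet_integrable hV2.stronglyMeasurable
  have hB1 : ∀ᵐ x ∂Pr.map X, Integrable (fun s => ‖V (x, s)‖ ^ 2) ν :=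
    (ae_map_iff hXm.aemeasurable hset).2 (hB.mono fun _ h => h.1)
  have hB2 : ∀ᵐ x ∂Pr.map X, ∫ s, ‖V (x, s)‖ ^ 2 ∂ν ≤ B ^ 2 :=
    (ae_map_iff hXm.aemeasurable (hin.measurable measurableSet_Iic)).2 (hB.mono fun _ h => h.2)
  have hnn : ∀ x, 0 ≤ ∫ s, ‖V (x, s)‖ ^ 2 ∂ν := fun x =>
    integral_nonneg fun _ => sq_nonneg _
  have hinI : Integrable (fun x => ∫ s, ‖V (x, s)‖ ^ 2 ∂ν) (Pr.map X) :=
    Integrable.of_bound hin.aestronglyMeasurable (B ^ 2) (hB2.mono fun x hx => by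
      rwa [Real.norm_of_nonneg (hnn x)])
  have hprod : Integrable (fun p => ‖V p‖ ^ 2) ((Pr.map X).prod ν) := by
    rw [integrable_prod_iff hV2.aestronglyMeasurable]
    refine ⟨hB1, ?_⟩
    simpa using hinI
  have hint : Integrable (fun ω => ‖V (X ω, ξ ω)‖ ^ 2) Pr := by
    rw [← hmap] at hprod
    exact (integrable_map_measure hV2.aestronglyMeasurable hpair.aemeasurable).1 hprod
  refine ⟨(memLp_two_iff_integrable_sq_norm
    (hV.comp hpair).aestronglyMeasurable).2 hint, ?_⟩
  have e1 : ∫ ω, ‖V (X ω, ξ ω)‖ ^ 2 ∂Pr = ∫ p, ‖V p‖ ^ 2 ∂Pr.map (fun ω => (X ω, ξ ω)) :=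
    (integral_map hpair.aemeasurable hV2.aestronglyMeasurable).symm
  rw [e1, hmap, integral_prod _ hprod]
  refine (integral_mono_ae hinI (integrable_const (B ^ 2)) hB2).trans_eq ?_
  simp

variable [InnerProductSpace ℝ H]

/-- Martingale orthogonality: integrate over the fresh sample first, with X and W frozen; the
centred oracle has mean zero. -/
theorem integral_inner_eq_zero_of_indep (hm : m ≤ mΩ) {ξ : Ω → S}
    (hξ : Measurable ξ) (hind : Indep m (MeasurableSpace.comap ξ inferInstance) Pr)
    (hν : Pr.map ξ = ν) {X : Ω → 𝒳} (hX : Measurable[m] X) {V : 𝒳 × S → H} (hV : Measurable V)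
    (hVi : ∀ᵐ ω ∂Pr, Integrable (fun s => V (X ω, s)) ν)
    (he : MemLp (fun ω => V (X ω, ξ ω) - ∫ s, V (X ω, s) ∂ν) 2 Pr)
    {W : Ω → H} (hW : Measurable[m] W) (hW2 : MemLp W 2 Pr) :
    ∫ ω, inner ℝ (V (X ω, ξ ω) - ∫ s, V (X ω, s) ∂ν) (W ω) ∂Pr = 0 := by
  have hXm : Measurable X := hX.mono hm le_rfl
  have hWm : Measurable W := hW.mono hm le_rfl
  have hXW : Measurable[m] fun ω => (X ω, W ω) := hX.prodMk hW
  have hpair : Measurable fun ω => ((X ω, W ω), ξ ω) := (hXm.prodMk hWm).prodMk hξ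
  have hmap := map_prodMk_of_indep hm hξ hind hν hXW
  have hprob : IsProbabilityMeasure (Pr.map fun ω => (X ω, W ω)) :=
    Measure.isProbabilityMeasure_map (hXm.prodMk hWm).aemeasurable
  set Φ : (𝒳 × H) × S → ℝ := fun p => inner ℝ (V (p.1.1, p.2) - ∫ s, V (p.1.1, s) ∂ν) p.1.2
    with hΦ
  have hmean : StronglyMeasurable fun x => ∫ s, V (x, s) ∂ν :=
    hV.stronglyMeasurable.integral_prod_right'
  have hΦm : Measurable Φ := by
    have h1 : Measurable fun p : (𝒳 × H) × S => V (p.1.1, p.2) := hV.comp (by fun_prop)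
    have h2 : Measurable fun p : (𝒳 × H) × S => ∫ s, V (p.1.1, s) ∂ν :=
      hmean.measurable.comp (by fun_prop)
    exact (h1.sub h2).inner (by fun_prop)
  have hint : Integrable (fun ω => Φ ((X ω, W ω), ξ ω)) Pr := integrable_inner_of_memLp he hW2
  have hint' : Integrable Φ ((Pr.map fun ω => (X ω, W ω)).prod ν) := by
    rw [← hmap]
    exact (integrable_map_measure hΦm.aestronglyMeasurable hpair.aemeasurable).2 hint
  have e1 : ∫ ω, inner ℝ (V (X ω, ξ ω) - ∫ s, V (X ω, s) ∂ν) (W ω) ∂Pr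
      = ∫ p, Φ p ∂Pr.map (fun ω => ((X ω, W ω), ξ ω)) :=
    (integral_map hpair.aemeasurable hΦm.aestronglyMeasurable).symm
  rw [e1, hmap, integral_prod _ hint', integral_map (hXm.prodMk hWm).aemeasurable
    hΦm.stronglyMeasurable.integral_prod_right'.aestronglyMeasurable]
  refine integral_eq_zero_of_ae (hVi.mono fun ω hω => ?_)
  simp only [hΦ, Pi.zero_apply]
  have h3 : ∀ s, inner ℝ (V (X ω, s) - ∫ s, V (X ω, s) ∂ν) (W ω)
      = inner ℝ (W ω) (V (X ω, s) - ∫ s, V (X ω, s) ∂ν) := fun s => real_inner_comm _ _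
  simp only [h3]
  have h4 : Integrable (fun s => V (X ω, s) - ∫ s, V (X ω, s) ∂ν) ν := hω.sub (integrable_const _)
  rw [integral_inner h4, integral_sub hω (integrable_const _)]
  simp

end Oracle

/-! ### Expected noise of an epoch. -/

section Noise

variable {Ω H : Type*} {mΩ : MeasurableSpace Ω} {Pr : Measure Ω} [IsProbabilityMeasure Pr]
  [NormedAddCommGroup H] [InnerProductSpace ℝ H] [ProperSpace H] [MeasurableSpace H] [BorelSpace H]

/-- The expected error of `T` stochastic proximal steps. -/
theorem integral_noise_le {η B : ℝ} (hη : 0 < η) {T : ℕ} {m : ℕ → MeasurableSpace Ω}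
    (hm : ∀ t, m t ≤ mΩ) (hmono : Monotone m) {u v g : ℕ → Ω → H}
    (hu : ∀ t, Measurable[m t] (u t)) (he : ∀ t, Measurable[m (t + 1)] (fun ω => v t ω - g t ω))
    (hstep : ∀ t ω, ‖u (t + 1) ω - u 0 ω‖ ≤ ‖u t ω - u 0 ω - η • v t ω‖)
    (hv2 : ∀ t < T, MemLp (v t) 2 Pr ∧ ∫ ω, ‖v t ω‖ ^ 2 ∂Pr ≤ B ^ 2)
    (he2 : ∀ t < T, MemLp (fun ω => v t ω - g t ω) 2 Pr ∧
      ∫ ω, ‖v t ω - g t ω‖ ^ 2 ∂Pr ≤ B ^ 2)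
    (horth : ∀ t < T, ∀ W : Ω → H, Measurable[m t] W → MemLp W 2 Pr →
      ∫ ω, inner ℝ (v t ω - g t ω) (W ω) ∂Pr = 0) :
    Integrable (fun ω => noise η B T (fun t => u t ω) (fun t => v t ω) (fun t => g t ω)) Pr ∧
      ∫ ω, noise η B T (fun t => u t ω) (fun t => v t ω) (fun t => g t ω) ∂Pr ≤
        η * B ^ 2 + η * T * B ^ 2 := by
  have hum : ∀ t, Measurable[m t] fun ω => u t ω - u 0 ω := fun t =>
    (hu t).sub ((hu 0).mono (hmono (Nat.zero_le t)) le_rfl)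
  -- Only displacements from `u 0` are shown square integrable; nothing of the kind is assumed of `u
  -- 0`, which is why `noise` is centred there.
  have hu2 : ∀ t ≤ T, MemLp (fun ω => u t ω - u 0 ω) 2 Pr := by
    intro t
    induction t with
    | zero => intro _; simp
    | succ t ih =>
      intro ht
      refine MemLp.of_le ((ih (by omega)).sub ((hv2 t (by omega)).1.const_smul η))
        ((hum (t + 1)).mono (hm _) le_rfl).aestronglyMeasurable (ae_of_all _ fun ω => ?_)
      exact hstep t ω
  have hSm : ∀ t, Measurable[m t] fun ω => ∑ i ∈ Finset.range t, (v i ω - g i ω) := fun t =>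
    Finset.measurable_fun_sum _ fun i hi =>
      (he i).mono (hmono (Finset.mem_range.1 hi)) le_rfl
  have hS2 : ∀ t ≤ T, MemLp (fun ω => ∑ i ∈ Finset.range t, (v i ω - g i ω)) 2 Pr := fun t ht =>
    memLp_finsetSum _ fun i hi => (he2 i (by have := Finset.mem_range.1 hi; omega)).1
  -- Orthogonality of the increments gives growth linear, not quadratic, in t.
  have hSB : ∀ t ≤ T, ∫ ω, ‖∑ i ∈ Finset.range t, (v i ω - g i ω)‖ ^ 2 ∂Pr ≤ t * B ^ 2 := by
    intro t
    induction t with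
    | zero => intro _; simp
    | succ t ih =>
      intro ht
      have e1 := he2 t (by omega)
      have e2 := hS2 t (by omega)
      have h1 : ∀ ω, ‖∑ i ∈ Finset.range (t + 1), (v i ω - g i ω)‖ ^ 2 =
          ‖∑ i ∈ Finset.range t, (v i ω - g i ω)‖ ^ 2
            + 2 * inner ℝ (v t ω - g t ω) (∑ i ∈ Finset.range t, (v i ω - g i ω))
            + ‖v t ω - g t ω‖ ^ 2 := fun ω => by
        rw [Finset.sum_range_succ, norm_add_sq_real, real_inner_comm]
      simp only [h1]
      have i1 := e2.integrable_norm_pow (p := 2) (by norm_num)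
      have i2 := e1.1.integrable_norm_pow (p := 2) (by norm_num)
      have i3 : Integrable (fun ω => 2 * inner ℝ (v t ω - g t ω)
        (∑ i ∈ Finset.range t, (v i ω - g i ω))) Pr := (integrable_inner_of_memLp e1.1 e2).const_mul 2
      have i13 : Integrable (fun ω => ‖∑ i ∈ Finset.range t, (v i ω - g i ω)‖ ^ 2
        + 2 * inner ℝ (v t ω - g t ω) (∑ i ∈ Finset.range t, (v i ω - g i ω))) Pr := i1.add i3
      rw [integral_add i13 i2, integral_add i1 i3, integral_const_mul,
        horth t (by omega) _ (hSm t) e2]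
      push_cast
      linarith [ih (by omega), e1.2]
  have iv : ∀ t ∈ Finset.range T, Integrable (fun ω => ‖v t ω‖ ^ 2) Pr := fun t ht =>
    (hv2 t (Finset.mem_range.1 ht)).1.integrable_norm_pow (p := 2) (by norm_num)
  have ie : ∀ t ∈ Finset.range T, Integrable
      (fun ω => inner ℝ (v t ω - g t ω) (u t ω - u 0 ω)) Pr := fun t ht =>
    integrable_inner_of_memLp (he2 t (Finset.mem_range.1 ht)).1 (hu2 t (Finset.mem_range.1 ht).le)
  have iS := (hS2 T le_rfl).integrable_norm_pow (p := 2) (by norm_num)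
  have i1 := (integrable_finsetSum _ iv).const_mul (η / 2)
  have i2 := iS.const_mul (η / 2)
  have i3 := integrable_finsetSum _ ie
  have i0 : Integrable (fun _ : Ω => η * B ^ 2) Pr := integrable_const _
  have i01 : Integrable (fun ω => η * B ^ 2 + η / 2 * ∑ t ∈ Finset.range T, ‖v t ω‖ ^ 2) Pr :=
    i0.add i1
  have i012 : Integrable (fun ω => η * B ^ 2 + η / 2 * ∑ t ∈ Finset.range T, ‖v t ω‖ ^ 2
    + η / 2 * ‖∑ t ∈ Finset.range T, (v t ω - g t ω)‖ ^ 2) Pr := i01.add i2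
  refine ⟨i012.sub i3, ?_⟩
  simp only [noise]
  rw [integral_sub i012 i3, integral_add i01 i2, integral_add i0 i1,
    integral_const_mul, integral_const_mul, integral_const_mul, integral_finsetSum _ iv, integral_finsetSum _ ie,
    Finset.sum_eq_zero (s := Finset.range T)
      (f := fun t => ∫ ω, inner ℝ (v t ω - g t ω) (u t ω - u 0 ω) ∂Pr)
      (fun t ht => horth t (Finset.mem_range.1 ht) _ (hum t)
        (hu2 t (Finset.mem_range.1 ht).le))]
  have hvs : ∑ t ∈ Finset.range T, ∫ ω, ‖v t ω‖ ^ 2 ∂Pr ≤ T * B ^ 2 := by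
    refine (Finset.sum_le_sum fun t ht => (hv2 t (Finset.mem_range.1 ht)).2).trans_eq ?_
    simp
  have b1 := mul_le_mul_of_nonneg_left hvs (half_pos hη).le
  have b2 := mul_le_mul_of_nonneg_left (hSB T le_rfl) (half_pos hη).le
  simp only [integral_const, probReal_univ, one_smul, sub_zero]
  linarith

end Noise

section OracleNoise

variable {Ω S 𝒳 H : Type*} {mΩ : MeasurableSpace Ω} [MeasurableSpace S] [MeasurableSpace 𝒳]
  {Pr : Measure Ω} [IsProbabilityMeasure Pr] {ν : Measure S} [IsProbabilityMeasure ν]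
  [NormedAddCommGroup H] [InnerProductSpace ℝ H] [ProperSpace H] [MeasurableSpace H] [BorelSpace H]

theorem integral_oracle_noise_le {η B : ℝ} (hη : 0 < η) {T : ℕ} {m : ℕ → MeasurableSpace Ω}
    (hm : ∀ t, m t ≤ mΩ) (hmono : Monotone m) {σ : ℕ → Ω → S} (hσ : ∀ t, Measurable[m (t + 1)] (σ t))
    (hind : ∀ t, Indep (m t) (MeasurableSpace.comap (σ t) inferInstance) Pr)
    (hν : ∀ t, Pr.map (σ t) = ν) {z : ℕ → Ω → 𝒳} (hz : ∀ t, Measurable[m t] (z t))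
    {V : 𝒳 × S → H} (hV : Measurable V) {u : ℕ → Ω → H} (hu : ∀ t, Measurable[m t] (u t))
    (hstep : ∀ t ω, ‖u (t + 1) ω - u 0 ω‖ ≤ ‖u t ω - u 0 ω - η • V (z t ω, σ t ω)‖)
    (hVi : ∀ t ω, Integrable (fun s => V (z t ω, s)) ν)
    (hB : ∀ t < T, ∀ᵐ ω ∂Pr, Integrable (fun s => ‖V (z t ω, s)‖ ^ 2) ν ∧
      ∫ s, ‖V (z t ω, s)‖ ^ 2 ∂ν ≤ B ^ 2) :
    Integrable (fun ω => noise η B T (fun t => u t ω) (fun t => V (z t ω, σ t ω))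
      (fun t => ∫ s, V (z t ω, s) ∂ν)) Pr ∧
      ∫ ω, noise η B T (fun t => u t ω) (fun t => V (z t ω, σ t ω))
        (fun t => ∫ s, V (z t ω, s) ∂ν) ∂Pr ≤ η * B ^ 2 + η * T * B ^ 2 := by
  have hmean : Measurable fun x => ∫ s, V (x, s) ∂ν :=
    hV.stronglyMeasurable.integral_prod_right'.measurable
  have hV' : Measurable fun p : 𝒳 × S => V p - ∫ s, V (p.1, s) ∂ν :=
    hV.sub (hmean.comp measurable_fst)
  have hσm : ∀ t, Measurable (σ t) := fun t => (hσ t).mono (hm _) le_rfl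
  have he2 : ∀ t < T, MemLp (fun ω => V (z t ω, σ t ω) - ∫ s, V (z t ω, s) ∂ν) 2 Pr ∧
      ∫ ω, ‖V (z t ω, σ t ω) - ∫ s, V (z t ω, s) ∂ν‖ ^ 2 ∂Pr ≤ B ^ 2 := fun t ht =>
    second_moment_le (hm t) (hσm t) (hind t) (hν t) (hz t) hV' ((hB t ht).mono fun ω hω =>
      (mean_and_variance_le (hVi t ω) hω.1 hω.2).2)
  refine integral_noise_le hη hm hmono hu (fun t => ?_) hstep (fun t ht =>
    second_moment_le (hm t) (hσm t) (hind t) (hν t) (hz t) hV (hB t ht)) he2 fun t ht W hW hW2 =>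
    integral_inner_eq_zero_of_indep (hm t) (hσm t) (hind t) (hν t) (hz t) hV
      (ae_of_all _ fun ω => hVi t ω) (he2 t ht).1 hW hW2
  exact hV'.comp (((hz t).mono (hmono (Nat.le_succ t)) le_rfl).prodMk (hσ t))

end OracleNoise

/-! ### Measurability and one epoch in expectation. -/

section Epoch

variable {E F S : Type*} [NormedAddCommGroup E] [InnerProductSpace ℝ E] [ProperSpace E]
  [NormedAddCommGroup F] [InnerProductSpace ℝ F] [ProperSpace F]
  [MeasurableSpace E] [BorelSpace E] [MeasurableSpace F] [BorelSpace F] [MeasurableSpace S]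
  {Y : Set F} {f : E → F → ℝ} {gx : E → F → E} {gy : E → F → F} {μ μy ρ : ℝ} {xstar : E}

/-- `Gx` and `Gy` are jointly measurable unbiased estimates of the partial gradients. -/
structure UnbiasedOracle (Y : Set F) (gx : E → F → E) (gy : E → F → F) (ν : Measure S)
    (Gx : E → F → S → E) (Gy : E → F → S → F) : Prop where
  measurable_x : Measurable fun p : E × F × S => Gx p.1 p.2.1 p.2.2
  measurable_y : Measurable fun p : E × F × S => Gy p.1 p.2.1 p.2.2
  unbiased_x : ∀ x, ∀ y ∈ Y, Integrable (Gx x y) ν ∧ ∫ s, Gx x y s ∂ν = gx x y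
  unbiased_y : ∀ x, ∀ y ∈ Y, Integrable (Gy x y) ν ∧ ∫ s, Gy x y s ∂ν = gy x y

/-- The second moments of the stochastic gradients at `z` are at most `B ^ 2`. -/
def MomentBound (ν : Measure S) (Gx : E → F → S → E) (Gy : E → F → S → F) (B : ℝ)
    (z : E × F) : Prop :=
  (Integrable (fun s => ‖Gx z.1 z.2 s‖ ^ 2) ν ∧ ∫ s, ‖Gx z.1 z.2 s‖ ^ 2 ∂ν ≤ B ^ 2) ∧
    (Integrable (fun s => ‖Gy z.1 z.2 s‖ ^ 2) ν ∧ ∫ s, ‖Gy z.1 z.2 s‖ ^ 2 ∂ν ≤ B ^ 2)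

theorem SaddleProblem.measurable_lyapunov (h : SaddleProblem Y f gx gy μ μy ρ xstar) {Ω : Type*}
    [MeasurableSpace Ω] {Z : Ω → E × F} (hZ : Measurable Z) (hZY : ∀ ω, (Z ω).2 ∈ Y) :
    Measurable fun ω => lyapunov Y f (μ / 4) xstar (Z ω) := by
  have hμ := h.mu_pos
  have hρ := h.rho_le
  have hγ : ρ < μ / 4 := by linarith
  -- An uncountable infimum of functions continuous in the centre and in y is upper semicontinuous,
  -- hence measurable. The subtype is used because f(w, ·) is only known to be continuous on Y.
  have husc : UpperSemicontinuous fun p : E × Y => ⨅ w, proximal f (μ / 4) p.1 w p.2 := by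
    refine upperSemicontinuous_ciInf (fun p => ?_) fun w => Continuous.upperSemicontinuous ?_
    · obtain ⟨x', hx'⟩ := h.exists_proximal_min hγ p.1 p.2.2
      refine ⟨proximal f (μ / 4) p.1 x' p.2, ?_⟩
      rintro _ ⟨w, rfl⟩
      have : 0 ≤ (μ / 4 - ρ) / 2 * ‖w - x'‖ ^ 2 := mul_nonneg (by linarith) (sq_nonneg _)
      linarith [hx' w]
    · have h1 : ContinuousOn (f w) Y := fun y hy =>
        (h.grad w y hy).2.hasFDerivWithinAt.continuousWithinAt
      have h2 : Continuous fun p : E × Y => f w p.2 :=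
        h1.domRestrict.comp continuous_snd
      exact h2.add (by fun_prop)
  have hP : Measurable (primal Y f) := h.differentiable.continuous.measurable
  have hinf : Measurable fun ω => ⨅ w, proximal f (μ / 4) (Z ω).1 w (Z ω).2 :=
    husc.measurable.comp (hZ.fst.prodMk (hZ.snd.subtype_mk (h := hZY)))
  have e : ∀ z : E × F, lyapunov Y f (μ / 4) xstar z =
      475 * (primal Y f z.1 - primal Y f xstar)
        + 57 * (primal Y f z.1 - ⨅ w, proximal f (μ / 4) z.1 w z.2) := fun z => by
    have : proximal f (μ / 4) z.1 z.1 = f z.1 := by ext y; simp [proximal]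
    rw [lyapunov, dualityGap, this]
    rfl
  simp only [e]
  have h1 : Measurable fun ω => primal Y f (Z ω).1 := hP.comp hZ.fst
  fun_prop

variable {Ω : Type*} {mΩ : MeasurableSpace Ω} {Pr : Measure Ω} {ν : Measure S}
  {Gx : E → F → S → E} {Gy : E → F → S → F} {m : ℕ → MeasurableSpace Ω} {σ : ℕ → Ω → S}
  {Z : Ω → E × F} {γ η B : ℝ}

/-- Measurability is read off the closed form of the step, as a choice of minimizers carries none by
itself. -/
theorem measurable_sgda (hne : Y.Nonempty) (hcl : IsClosed Y) (hconv : Convex ℝ Y)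
    (ho : UnbiasedOracle Y gx gy ν Gx Gy) (hγη : 0 ≤ γ * η) (hmono : Monotone m)
    (hσ : ∀ t, Measurable[m (t + 1)] (σ t)) (hZ : Measurable[m 0] Z) (t : ℕ) :
    Measurable[m t] fun ω => sgda Y Gx Gy γ η (Z ω) (fun j => σ j ω) t := by
  obtain ⟨π, hπ⟩ := exists_isProjection hne hcl hconv
  induction t with
  | zero => exact hZ
  | succ t ih =>
    have hΨ : Measurable fun p : (E × F) × (E × F) × S =>
        (((1 + γ * η)⁻¹ • (p.2.1.1 - η • Gx p.2.1.1 p.2.1.2 p.2.2 + (γ * η) • p.1.1),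
          π (p.2.1.2 - -(η • Gy p.2.1.1 p.2.1.2 p.2.2))) : E × F) := by
      have h1 : Measurable fun p : (E × F) × (E × F) × S => Gx p.2.1.1 p.2.1.2 p.2.2 :=
        ho.measurable_x.comp (g := fun p : E × F × S => Gx p.1 p.2.1 p.2.2)
          (f := fun p : (E × F) × (E × F) × S => (p.2.1.1, p.2.1.2, p.2.2)) (by fun_prop)
      have h2 : Measurable fun p : (E × F) × (E × F) × S => Gy p.2.1.1 p.2.1.2 p.2.2 :=
        ho.measurable_y.comp (g := fun p : E × F × S => Gy p.1 p.2.1 p.2.2)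
          (f := fun p : (E × F) × (E × F) × S => (p.2.1.1, p.2.1.2, p.2.2)) (by fun_prop)
      have h3 : Measurable fun p : (E × F) × (E × F) × S => p.2.1.1 := by fun_prop
      have h4 : Measurable fun p : (E × F) × (E × F) × S => p.2.1.2 := by fun_prop
      have h5 : Measurable fun p : (E × F) × (E × F) × S => p.1.1 := by fun_prop
      exact (((h3.sub (h1.const_smul η)).add (h5.const_smul (γ * η))).const_smul _).prodMk
        (hπ.continuous.measurable.comp (h4.sub (h2.const_smul η).neg))
    have h3 := hΨ.comp ((hZ.mono (hmono (Nat.zero_le (t + 1))) le_rfl).prodMk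
      ((ih.mono (hmono (Nat.le_succ t)) le_rfl).prodMk (hσ t)))
    convert h3 using 1
    ext1 ω
    exact proxStep_eq hπ hγη _ _ _

/-- The effect of an epoch on the expectation of the Lyapunov function. -/
theorem SaddleProblem.integral_lyapunov_sgdaAverage_le [IsProbabilityMeasure Pr]
    [IsProbabilityMeasure ν]
    (h : SaddleProblem Y f gx gy μ μy ρ xstar) (ho : UnbiasedOracle Y gx gy ν Gx Gy)
    (hη : 0 < η) {T : ℕ} (hT : 0 < T) (hηT : 768 ≤ η * T * min (μ / 8) μy)
    (hm : ∀ t, m t ≤ mΩ) (hmono : Monotone m) (hσ : ∀ t, Measurable[m (t + 1)] (σ t))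
    (hind : ∀ t, Indep (m t) (MeasurableSpace.comap (σ t) inferInstance) Pr)
    (hν : ∀ t, Pr.map (σ t) = ν) (hZ : Measurable[m 0] Z) (hZY : ∀ ω, (Z ω).2 ∈ Y)
    (hB : ∀ t ≤ T, ∀ᵐ ω ∂Pr,
      MomentBound ν Gx Gy B (sgda Y Gx Gy (μ / 4) η (Z ω) (fun j => σ j ω) t))
    (hint : Integrable (fun ω => lyapunov Y f (μ / 4) xstar (Z ω)) Pr) :
    Integrable (fun ω => lyapunov Y f (μ / 4) xstar
      (sgdaAverage Y Gx Gy (μ / 4) η T (Z ω) (fun j => σ j ω))) Pr ∧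
    ∫ ω, lyapunov Y f (μ / 4) xstar
      (sgdaAverage Y Gx Gy (μ / 4) η T (Z ω) (fun j => σ j ω)) ∂Pr ≤
      1 / 2 * ∫ ω, lyapunov Y f (μ / 4) xstar (Z ω) ∂Pr + 330752 / 127 * (η * B ^ 2) := by
  have hμ := h.mu_pos
  have hγη : 0 ≤ μ / 4 * η := by positivity
  have hT1 : (1 : ℝ) ≤ T := by exact_mod_cast hT
  obtain ⟨π, hπ⟩ := exists_isProjection h.nonempty h.isClosed h.convex
  set z : ℕ → Ω → E × F := fun t ω => sgda Y Gx Gy (μ / 4) η (Z ω) (fun j => σ j ω) t with hzdef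
  have hz : ∀ t, Measurable[m t] (z t) := fun t =>
    measurable_sgda h.nonempty h.isClosed h.convex ho hγη hmono hσ hZ t
  have hzY : ∀ t ω, (z t ω).2 ∈ Y := fun t ω =>
    sgda_mem h.nonempty h.isClosed h.convex Gx Gy hγη _ (hZY ω) _ t
  have hsucc : ∀ t ω, z (t + 1) ω =
      ((1 + μ / 4 * η)⁻¹ • ((z t ω).1 - η • Gx (z t ω).1 (z t ω).2 (σ t ω)
        + (μ / 4 * η) • (z 0 ω).1),
        π ((z t ω).2 - -(η • Gy (z t ω).1 (z t ω).2 (σ t ω)))) := fun t ω =>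
    proxStep_eq hπ hγη _ _ _
  set Nx : Ω → ℝ := fun ω => noise η B T (fun t => (z t ω).1)
    (fun t => Gx (z t ω).1 (z t ω).2 (σ t ω)) (fun t => gx (z t ω).1 (z t ω).2) with hNx
  set Ny : Ω → ℝ := fun ω => noise η B T (fun t => (z t ω).2)
    (fun t => -Gy (z t ω).1 (z t ω).2 (σ t ω)) (fun t => -gy (z t ω).1 (z t ω).2) with hNy
  have hx : Integrable Nx Pr ∧ ∫ ω, Nx ω ∂Pr ≤ η * B ^ 2 + η * T * B ^ 2 := by
    have := integral_oracle_noise_le (B := B) (T := T) hη hm hmono hσ hind hν hz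
      (V := fun p : (E × F) × S => Gx p.1.1 p.1.2 p.2)
      (ho.measurable_x.comp (g := fun p : E × F × S => Gx p.1 p.2.1 p.2.2)
        (f := fun p : (E × F) × S => (p.1.1, p.1.2, p.2)) (by fun_prop))
      (u := fun t ω => (z t ω).1) (fun t => (hz t).fst)
      (fun t ω => by
        simp only [hsucc]
        exact norm_prox_sub_le hγη _ _ _)
      (fun t ω => (ho.unbiased_x (z t ω).1 _ (hzY t ω)).1) (fun t ht => (hB t ht.le).mono fun ω hω => hω.1)
    simpa only [hNx, (ho.unbiased_x _ _ (hzY _ _)).2] using this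
  have hy : Integrable Ny Pr ∧ ∫ ω, Ny ω ∂Pr ≤ η * B ^ 2 + η * T * B ^ 2 := by
    have := integral_oracle_noise_le (B := B) (T := T) hη hm hmono hσ hind hν hz
      (V := fun p : (E × F) × S => -Gy p.1.1 p.1.2 p.2)
      (ho.measurable_y.comp (g := fun p : E × F × S => Gy p.1 p.2.1 p.2.2)
        (f := fun p : (E × F) × S => (p.1.1, p.1.2, p.2)) (by fun_prop)).neg
      (u := fun t ω => (z t ω).2) (fun t => (hz t).snd)
      (fun t ω => by
        simp only [hsucc]
        have h1 := hπ.norm_sub_le ((z t ω).2 - -(η • Gy (z t ω).1 (z t ω).2 (σ t ω))) (z 0 ω).2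
        rw [hπ.eq_self (hzY 0 ω)] at h1
        refine h1.trans_eq ?_
        congr 1
        module)
      (fun t ω => (ho.unbiased_y (z t ω).1 _ (hzY t ω)).1.neg) (fun t ht => (hB t ht.le).mono fun ω hω => by
        simpa only [norm_neg] using hω.2)
    simpa only [hNy, integral_neg, (ho.unbiased_y _ _ (hzY _ _)).2] using this
  set A : Ω → E × F := fun ω => sgdaAverage Y Gx Gy (μ / 4) η T (Z ω) (fun j => σ j ω) with hA
  have hAm : Measurable A := by
    simp only [hA, sgdaAverage_eq]
    exact (Finset.measurable_fun_sum (Finset.range T)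
      fun t _ => (hz (t + 1)).mono (hm _) le_rfl).const_smul (T : ℝ)⁻¹
  have hAY : ∀ ω, (A ω).2 ∈ Y := fun ω =>
    sgdaAverage_mem h.nonempty h.isClosed h.convex Gx Gy hγη hT _ (hZY ω) _
  have hbound : ∀ᵐ ω ∂Pr, lyapunov Y f (μ / 4) xstar (A ω) ≤
      1 / 2 * lyapunov Y f (μ / 4) xstar (Z ω) + 82688 / 127 * ((T : ℝ)⁻¹ * (Nx ω + Ny ω)) := by
    have hall : ∀ᵐ ω ∂Pr, ∀ t, t ≤ T → MomentBound ν Gx Gy B (z t ω) :=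
      ae_all_iff.2 fun t => by
        by_cases ht : t ≤ T
        · exact (hB t ht).mono fun ω hω _ => hω
        · exact ae_of_all _ fun ω h => absurd h ht
    filter_upwards [hall] with ω hω
    refine h.lyapunov_sgdaAverage_le Gx Gy hη hT hηT (Z ω) (hZY ω) (fun j => σ j ω) fun t ht => ?_
    have e1 := ho.unbiased_x (z t ω).1 _ (hzY t ω)
    have e2 := ho.unbiased_y (z t ω).1 _ (hzY t ω)
    have b1 := (mean_and_variance_le e1.1 (hω t ht).1.1 (hω t ht).1.2).1
    have b2 := (mean_and_variance_le e2.1 (hω t ht).2.1 (hω t ht).2.2).1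
    rw [e1.2] at b1
    rw [e2.2] at b2
    exact ⟨b1, b2⟩
  have i1 := hint.const_mul (1 / 2)
  have i2 := ((hx.1.add hy.1).const_mul (T : ℝ)⁻¹).const_mul (82688 / 127)
  have i3 : Integrable (fun ω => 1 / 2 * lyapunov Y f (μ / 4) xstar (Z ω)
      + 82688 / 127 * ((T : ℝ)⁻¹ * (Nx ω + Ny ω))) Pr := i1.add i2
  have hAint : Integrable (fun ω => lyapunov Y f (μ / 4) xstar (A ω)) Pr :=
    i3.mono' (h.measurable_lyapunov hAm hAY).aestronglyMeasurable (hbound.mono fun ω hω => by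
      rwa [Real.norm_of_nonneg (h.lyapunov_nonneg _ (hAY ω))])
  refine ⟨hAint, (integral_mono_ae hAint i3 hbound).trans ?_⟩
  have e : ∫ ω, (1 / 2 * lyapunov Y f (μ / 4) xstar (Z ω)
      + 82688 / 127 * ((T : ℝ)⁻¹ * (Nx ω + Ny ω))) ∂Pr =
      1 / 2 * ∫ ω, lyapunov Y f (μ / 4) xstar (Z ω) ∂Pr
        + 82688 / 127 * ((T : ℝ)⁻¹ * (∫ ω, Nx ω ∂Pr + ∫ ω, Ny ω ∂Pr)) := by
    rw [← integral_add hx.1 hy.1, ← integral_const_mul, ← integral_const_mul, ← integral_const_mul]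
    exact integral_add i1 i2
  rw [e]
  have hBη : 0 ≤ η * B ^ 2 := by positivity
  -- Each block contributes ηB²(1 + T) ≤ 2TηB².
  have hfin : (T : ℝ)⁻¹ * (∫ ω, Nx ω ∂Pr + ∫ ω, Ny ω ∂Pr) ≤ 4 * (η * B ^ 2) := by
    rw [← div_eq_inv_mul, div_le_iff₀ (by linarith)]
    nlinarith [hx.2, hy.2]
  linarith

end Epoch

/-! ### The filtration of the samples. -/

section Samples

variable {Ω S : Type*} {mΩ : MeasurableSpace Ω} [MeasurableSpace S] {Pr : Measure Ω}
  {ξ : ℕ → ℕ → Ω → S}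

/-- The σ-algebra generated by the samples before sample `t` of epoch `k`. -/
@[reducible] def past (ξ : ℕ → ℕ → Ω → S) (k t : ℕ) : MeasurableSpace Ω :=
  ⨆ i ∈ {i : ℕ × ℕ | i.1 < k ∨ i.1 = k ∧ i.2 < t}, MeasurableSpace.comap (ξ i.1 i.2) inferInstance

theorem past_le (hξ : ∀ k t, Measurable (ξ k t)) (k t : ℕ) : past ξ k t ≤ mΩ :=
  iSup₂_le fun i _ => (hξ i.1 i.2).comap_le

theorem past_mono (k : ℕ) : Monotone (past ξ k) := fun _ _ hst =>
  biSup_mono fun _ hi => hi.imp_right fun h => ⟨h.1, h.2.trans_le hst⟩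

theorem past_le_succ (k t : ℕ) : past ξ k t ≤ past ξ (k + 1) 0 :=
  biSup_mono fun i (hi : i.1 < k ∨ i.1 = k ∧ i.2 < t) => Or.inl (by omega)

theorem measurable_past (k t : ℕ) : Measurable[past ξ k (t + 1)] (ξ k t) :=
  measurable_iff_comap_le.2 (le_iSup₂_of_le (f := fun (i : ℕ × ℕ)
    (_ : i ∈ {i : ℕ × ℕ | i.1 < k ∨ i.1 = k ∧ i.2 < t + 1}) =>
      MeasurableSpace.comap (ξ i.1 i.2) inferInstance) (k, t)
    (Or.inr ⟨rfl, Nat.lt_succ_self t⟩) le_rfl)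

theorem indep_past (hξ : ∀ k t, Measurable (ξ k t))
    (hind : iIndepFun (fun i : ℕ × ℕ => ξ i.1 i.2) Pr) (k t : ℕ) :
    Indep (past ξ k t) (MeasurableSpace.comap (ξ k t) inferInstance) Pr := by
  have h := indep_iSup_of_disjoint (fun i : ℕ × ℕ => (hξ i.1 i.2).comap_le) hind.iIndep
    (S := {i : ℕ × ℕ | i.1 < k ∨ i.1 = k ∧ i.2 < t}) (T := {(k, t)}) (by
      rw [Set.disjoint_singleton_right]
      simp)
  simpa [past] using h

end Samples

theorem exp_sixteenth_le : Real.exp (1 / 16) ≤ 16 / 15 := by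
  have h1 := Real.add_one_le_exp (-(1 / 16) : ℝ)
  rw [Real.exp_neg] at h1
  rw [← inv_inv (Real.exp (1 / 16))]
  exact (inv_anti₀ (by norm_num) h1).trans (by norm_num)

/-! ### The recursion over epochs. -/

section Recursion

variable {E F S : Type*} [NormedAddCommGroup E] [InnerProductSpace ℝ E] [ProperSpace E]
  [NormedAddCommGroup F] [InnerProductSpace ℝ F] [ProperSpace F]
  [MeasurableSpace E] [BorelSpace E] [MeasurableSpace F] [BorelSpace F] [MeasurableSpace S]
  {Y : Set F} {f : E → F → ℝ} {gx : E → F → E} {gy : E → F → F} {μ μy ρ : ℝ} {xstar : E}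
  {Ω : Type*} {mΩ : MeasurableSpace Ω} {Pr : Measure Ω} [IsProbabilityMeasure Pr]
  {ν : Measure S} [IsProbabilityMeasure ν]
  {Gx : E → F → S → E} {Gy : E → F → S → F} {ξ : ℕ → ℕ → Ω → S}

theorem stepSize_succ (η₀ : ℝ) (k : ℕ) :
    stepSize η₀ (k + 1) = η₀ * Real.exp (-(k / 16 : ℝ)) := by
  rw [stepSize]; congr 2; push_cast; ring

theorem le_epochLength_succ (η₀ μ μy : ℝ) (k : ℕ) :
    768 / (η₀ * min (μ / 8) μy) * Real.exp (k / 16) ≤ epochLength η₀ μ μy (k + 1) := by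
  rw [epochLength]
  refine le_trans (le_of_eq ?_) (Nat.le_ceil _)
  push_cast
  rw [add_sub_cancel_right]

/-- The expectation of the Lyapunov function after `k` epochs. -/
theorem SaddleProblem.integral_lyapunov_pes_le
    (h : SaddleProblem Y f gx gy μ μy ρ xstar) (ho : UnbiasedOracle Y gx gy ν Gx Gy)
    {η₀ B D : ℝ} (hη₀ : 0 < η₀) (z₀ : E × F) (hz₀ : z₀.2 ∈ Y)
    (hD : lyapunov Y f (μ / 4) xstar z₀ ≤ D)
    (hξ : ∀ k t, Measurable (ξ k t)) (hν : ∀ k t, Pr.map (ξ k t) = ν)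
    (hind : iIndepFun (fun i : ℕ × ℕ => ξ i.1 i.2) Pr)
    (hB : ∀ k, ∀ t ≤ epochLength η₀ μ μy (k + 1), ∀ᵐ ω ∂Pr, MomentBound ν Gx Gy B
      (pesInner Y Gx Gy (μ / 4) (stepSize η₀) (epochLength η₀ μ μy) z₀ (fun i j => ξ i j ω) k t))
    (k : ℕ) :
    let Z : Ω → E × F := fun ω =>
      pes Y Gx Gy (μ / 4) (stepSize η₀) (epochLength η₀ μ μy) z₀ (fun i j => ξ i j ω) k
    (Measurable[past ξ (k + 1) 0] Z ∧ ∀ ω, (Z ω).2 ∈ Y) ∧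
    Integrable (fun ω => lyapunov Y f (μ / 4) xstar (Z ω)) Pr ∧
    ∫ ω, lyapunov Y f (μ / 4) xstar (Z ω) ∂Pr ≤
      Real.exp (-(k / 16 : ℝ)) * (D + k * (2782 * (η₀ * B ^ 2))) := by
  have hμ := h.mu_pos
  have hm : 0 < min (μ / 8) μy := lt_min (by linarith) h.muy_pos
  have hD0 : 0 ≤ D := (h.lyapunov_nonneg z₀ hz₀).trans hD
  induction k with
  | zero =>
    refine ⟨⟨measurable_const, fun _ => hz₀⟩,
      integrable_const (lyapunov Y f (μ / 4) xstar z₀), ?_⟩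
    simpa [pes] using hD
  | succ k ih =>
    intro Z'
    simp only at ih
    set Z : Ω → E × F := fun ω =>
      pes Y Gx Gy (μ / 4) (stepSize η₀) (epochLength η₀ μ μy) z₀ (fun i j => ξ i j ω) k with hZ
    obtain ⟨⟨hZm, hZY⟩, hZi, hZb⟩ := ih
    set η := stepSize η₀ (k + 1) with hη
    set T := epochLength η₀ μ μy (k + 1) with hT
    have hηe : η = η₀ * Real.exp (-(k / 16 : ℝ)) := stepSize_succ η₀ k
    have hηpos : 0 < η := by rw [hηe]; positivity
    have hTle := le_epochLength_succ η₀ μ μy k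
    rw [← hT] at hTle
    have hTpos : 0 < T := by
      have : (0 : ℝ) < T := lt_of_lt_of_le (by positivity) hTle
      exact_mod_cast this
    have hηT : 768 ≤ η * T * min (μ / 8) μy := by
      have h1 := mul_le_mul_of_nonneg_left hTle (mul_pos hηpos hm).le
      have h2 : η * min (μ / 8) μy * (768 / (η₀ * min (μ / 8) μy) * Real.exp (k / 16)) = 768 := by
        rw [hηe, Real.exp_neg]
        field_simp
      linarith
    have hγη : 0 ≤ μ / 4 * η := by positivity
    have hZ' : Z' = fun ω => sgdaAverage Y Gx Gy (μ / 4) η T (Z ω) (fun j => ξ (k + 1) j ω) := rfl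
    have hZ'Y : ∀ ω, (Z' ω).2 ∈ Y := fun ω =>
      sgdaAverage_mem h.nonempty h.isClosed h.convex Gx Gy hγη hTpos _ (hZY ω) _
    have hZ'm : Measurable[past ξ (k + 1 + 1) 0] Z' := by
      rw [hZ']
      simp only [sgdaAverage_eq]
      exact (Finset.measurable_fun_sum (Finset.range T) fun t _ =>
        (measurable_sgda h.nonempty h.isClosed h.convex ho hγη (past_mono (k + 1))
          (measurable_past (k + 1)) hZm (t + 1)).mono (past_le_succ _ _) le_rfl).const_smul (T : ℝ)⁻¹
    obtain ⟨hi, hb⟩ := h.integral_lyapunov_sgdaAverage_le ho (B := B) hηpos hTpos hηT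
      (past_le hξ (k + 1)) (past_mono (k + 1)) (measurable_past (k + 1))
      (indep_past hξ hind (k + 1)) (hν (k + 1)) hZm hZY (hB k) hZi
    refine ⟨⟨hZ'm, hZ'Y⟩, hi, hb.trans ?_⟩
    -- The bound q ≥ 15/16 serves twice: the contraction 1/2 is at most q, and 2782 q exceeds the
    -- noise constant 330752/127.
    set q := Real.exp (-(1 / 16 : ℝ)) with hq
    have hq1 : 15 / 16 ≤ q := by have := Real.add_one_le_exp (-(1 / 16) : ℝ); linarith
    have hexp : Real.exp (-(((k + 1 : ℕ) : ℝ) / 16)) = Real.exp (-(k / 16 : ℝ)) * q := by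
      rw [hq, ← Real.exp_add]; congr 1; push_cast; ring
    rw [hexp, hηe]
    set e := Real.exp (-(k / 16 : ℝ)) with he
    have he0 : 0 < e := Real.exp_pos _
    have hβ : 0 ≤ η₀ * B ^ 2 := by positivity
    have hX : 0 ≤ D + k * (2782 * (η₀ * B ^ 2)) := by positivity
    have c1 : 1 / 2 * (e * (D + k * (2782 * (η₀ * B ^ 2)))) ≤
        q * (e * (D + k * (2782 * (η₀ * B ^ 2)))) :=
      mul_le_mul_of_nonneg_right (by linarith) (by positivity)
    have c2 : 330752 / 127 * (e * (η₀ * B ^ 2)) ≤ q * 2782 * (e * (η₀ * B ^ 2)) :=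
      mul_le_mul_of_nonneg_right (by linarith) (by positivity)
    push_cast
    linarith

end Recursion

/-! ### Number of epochs and total iteration count. -/

section Complexity

variable {ε₀ η₀ B ε : ℝ}

theorem enoughEpochs_iff (hε₀ : 0 < ε₀) (hη₀ : 0 < η₀) (hB : 0 < B) (hε : 0 < ε) (K : ℕ) :
    EnoughEpochs ε₀ η₀ B ε K ↔ 1 ≤ K ∧ 1200 * ε₀ ≤ ε * Real.exp (K / 16) ∧
      6000 * η₀ * K * B ^ 2 ≤ ε * Real.exp (K / 16) := by
  have key : ∀ a : ℝ, 0 < a → (16 * Real.log (a / ε) ≤ K ↔ a ≤ ε * Real.exp (K / 16)) := by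
    intro a ha
    rw [← le_div_iff₀' (by norm_num), Real.log_le_iff_le_exp (by positivity), div_le_iff₀' hε]
  rw [EnoughEpochs, max_le_iff]
  refine and_congr_right fun hK => ?_
  have : (0 : ℝ) < K := by exact_mod_cast hK
  rw [key _ (by positivity), key _ (by positivity)]

theorem eventually_affine_le_exp {δ : ℝ} (hδ : 0 < δ) (a b : ℝ) :
    ∀ᶠ K : ℕ in atTop, a ≤ Real.exp (δ * K) ∧ b * K ≤ Real.exp (δ * K) := by
  have h1 : Tendsto (fun K : ℕ => δ * (K : ℝ)) atTop atTop :=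
    tendsto_natCast_atTop_atTop.const_mul_atTop hδ
  filter_upwards [(Real.tendsto_exp_atTop.comp h1).eventually_ge_atTop a,
    tendsto_natCast_atTop_atTop.eventually_ge_atTop (2 * b / δ ^ 2)] with K ha hK
  refine ⟨ha, ?_⟩
  have h2 := Real.quadratic_le_exp_of_nonneg (x := δ * K) (by positivity)
  rw [div_le_iff₀ (by positivity)] at hK
  have h3 : (0 : ℝ) ≤ K := by positivity
  nlinarith

theorem exists_enoughEpochs (hε₀ : 0 < ε₀) (hη₀ : 0 < η₀) (hB : 0 < B) (hε : 0 < ε) :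
    ∃ K, EnoughEpochs ε₀ η₀ B ε K := by
  obtain ⟨K, hK, hK1⟩ := ((eventually_affine_le_exp (δ := 1 / 16) (by norm_num) (1200 * ε₀ / ε)
    (6000 * η₀ * B ^ 2 / ε)).and (eventually_ge_atTop 1)).exists
  refine ⟨K, (enoughEpochs_iff hε₀ hη₀ hB hε K).2 ⟨hK1, ?_, ?_⟩⟩
  · have := hK.1
    rwa [div_le_iff₀' hε, one_div_mul_eq_div] at this
  · have := hK.2
    rw [div_mul_eq_mul_div, div_le_iff₀' hε, one_div_mul_eq_div] at this
    linarith

theorem exists_isLeast_enoughEpochs (hε₀ : 0 < ε₀) (hη₀ : 0 < η₀) (hB : 0 < B) (hε : 0 < ε) :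
    ∃ K, IsLeast {K : ℕ | EnoughEpochs ε₀ η₀ B ε K} K := by
  classical
  have h := exists_enoughEpochs hε₀ hη₀ hB hε
  exact ⟨Nat.find h, Nat.find_spec h, fun n hn => Nat.find_min' h hn⟩

/-- Geometric sum with ratio exp(1/16) ≥ 17/16, so 12288 = 16 · 768; the summand K pays for rounding
up, and a factor 8 passes from min(μ/8, μ_y) to min(μ, μ_y). -/
theorem totalIterations_le {μ μy : ℝ} (hη₀ : 0 < η₀) (hμ : 0 < μ) (hμy : 0 < μy) (K : ℕ) :
    (totalIterations η₀ μ μy K : ℝ) ≤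
      98304 / (η₀ * min μ μy) * Real.exp (K / 16) + K := by
  have hm : 0 < min (μ / 8) μy := lt_min (by linarith) hμy
  have hm' : 0 < min μ μy := lt_min hμ hμy
  have hmm : min μ μy / 8 ≤ min (μ / 8) μy :=
    le_min (by linarith [min_le_left μ μy]) (by linarith [min_le_right μ μy])
  have h1 : (totalIterations η₀ μ μy K : ℝ) ≤
      12288 / (η₀ * min (μ / 8) μy) * Real.exp (K / 16) + K := by
    induction K with
    | zero => simp [totalIterations]; positivity
    | succ K ih =>
      have h0 : totalIterations η₀ μ μy (K + 1) =
          totalIterations η₀ μ μy K + epochLength η₀ μ μy (K + 1) :=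
        Finset.sum_Icc_succ_top (by omega) _
      rw [h0]
      have h2 : (epochLength η₀ μ μy (K + 1) : ℝ) ≤
          768 / (η₀ * min (μ / 8) μy) * Real.exp (K / 16) + 1 := by
        rw [epochLength]
        refine (Nat.ceil_lt_add_one (by positivity)).le.trans_eq ?_
        push_cast
        rw [add_sub_cancel_right]
      have h3 : 17 / 16 * Real.exp ((K : ℝ) / 16) ≤ Real.exp (((K + 1 : ℕ) : ℝ) / 16) := by
        have : (((K + 1 : ℕ) : ℝ) / 16) = 1 / 16 + K / 16 := by push_cast; ring
        rw [this, Real.exp_add]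
        have := Real.add_one_le_exp (1 / 16 : ℝ)
        gcongr
        linarith
      have h4 := mul_le_mul_of_nonneg_left h3
        (show 0 ≤ 12288 / (η₀ * min (μ / 8) μy) by positivity)
      have h5 : 12288 / (η₀ * min (μ / 8) μy) * (17 / 16 * Real.exp ((K : ℝ) / 16)) =
        12288 / (η₀ * min (μ / 8) μy) * Real.exp ((K : ℝ) / 16)
          + 768 / (η₀ * min (μ / 8) μy) * Real.exp ((K : ℝ) / 16) := by ring
      push_cast at *
      linarith
  refine h1.trans ?_
  refine add_le_add (mul_le_mul_of_nonneg_right ?_ (Real.exp_pos _).le) le_rfl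
  rw [div_le_div_iff₀ (by positivity) (by positivity)]
  nlinarith

/-- K - 1 epochs violate one of the two conditions, and one more epoch costs a factor 16/15: 6000 ·
16/15 = 6400. -/
theorem exp_least_le (hε₀ : 0 < ε₀) (hη₀ : 0 < η₀) (hB : 0 < B) (hε : 0 < ε) (hεε : ε ≤ ε₀)
    {K : ℕ} (hK : IsLeast {K : ℕ | EnoughEpochs ε₀ η₀ B ε K} K) :
    Real.exp (K / 16) ≤ 6400 * max ε₀ (η₀ * (K * B ^ 2)) / ε := by
  obtain ⟨hK1, hKa, -⟩ := (enoughEpochs_iff hε₀ hη₀ hB hε K).1 hK.1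
  obtain ⟨n, rfl⟩ : ∃ n, K = n + 1 := ⟨K - 1, by omega⟩
  have hexp : Real.exp (((n + 1 : ℕ) : ℝ) / 16) = Real.exp (1 / 16) * Real.exp (n / 16) := by
    rw [← Real.exp_add]; congr 1; push_cast; ring
  have h16 := exp_sixteenth_le
  have hle : Real.exp (((n + 1 : ℕ) : ℝ) / 16) ≤ 16 / 15 * Real.exp (n / 16) := by
    rw [hexp]; gcongr
  -- K = 1 is impossible for ε ≤ ε₀, as 1200 exceeds exp(1/16); so K - 1 is a legitimate candidate.
  have hn : 1 ≤ n := by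
    by_contra hn
    obtain rfl : n = 0 := by omega
    simp only [CharP.cast_eq_zero, zero_div, Real.exp_zero] at hle
    have := mul_le_mul_of_nonneg_left hle hε.le
    linarith
  have hnot : ¬ EnoughEpochs ε₀ η₀ B ε n := fun hcon => by
    have := hK.2 hcon
    omega
  have hmax1 := le_max_left ε₀ (η₀ * (((n + 1 : ℕ) : ℝ) * B ^ 2))
  have hmax2 := le_max_right ε₀ (η₀ * (((n + 1 : ℕ) : ℝ) * B ^ 2))
  have hlt : ε * Real.exp (n / 16) ≤ 6000 * max ε₀ (η₀ * (((n + 1 : ℕ) : ℝ) * B ^ 2)) := by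
    by_contra hcon
    push Not at hcon
    refine hnot ((enoughEpochs_iff hε₀ hη₀ hB hε n).2 ⟨hn, by linarith, ?_⟩)
    have h1 : η₀ * ((n : ℝ) * B ^ 2) ≤ η₀ * (((n + 1 : ℕ) : ℝ) * B ^ 2) := by
      gcongr; exact Nat.le_succ n
    linarith
  rw [le_div_iff₀' hε]
  have := mul_le_mul_of_nonneg_left hle hε.le
  linarith

theorem totalIterations_least_le {μ μy : ℝ} (hμ : 0 < μ) (hμy : 0 < μy) (hε₀ : 0 < ε₀)
    (hη₀ : 0 < η₀) (hB : 0 < B) (hε : 0 < ε) (hεε : ε ≤ ε₀)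
    {K : ℕ} (hK : IsLeast {K : ℕ | EnoughEpochs ε₀ η₀ B ε K} K) :
    (totalIterations η₀ μ μy K : ℝ) ≤
      700000000 * (max (ε₀ / η₀) (K * B ^ 2) / (min μ μy * ε)) + K := by
  have hm : 0 < min μ μy := lt_min hμ hμy
  refine (totalIterations_le hη₀ hμ hμy K).trans ?_
  have h1 := exp_least_le hε₀ hη₀ hB hε hεε hK
  have e1 : max ε₀ (η₀ * (K * B ^ 2)) = η₀ * max (ε₀ / η₀) (K * B ^ 2) := by
    rw [mul_max_of_nonneg _ _ hη₀.le, mul_div_cancel₀ _ hη₀.ne']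
  rw [e1] at h1
  have h2 := mul_le_mul_of_nonneg_left h1 (show 0 ≤ 98304 / (η₀ * min μ μy) by positivity)
  have e2 : 98304 / (η₀ * min μ μy) * (6400 * (η₀ * max (ε₀ / η₀) (K * B ^ 2)) / ε) =
      629145600 * (max (ε₀ / η₀) (K * B ^ 2) / (min μ μy * ε)) := by
    field_simp; ring
  have h3 : 0 ≤ max (ε₀ / η₀) (K * B ^ 2) / (min μ μy * ε) := by positivity
  linarith

theorem exists_least_enoughEpochs_le_log (hε₀ : 0 < ε₀) (hη₀ : 0 < η₀) (hB : 0 < B) :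
    ∃ εbar : ℝ, 0 < εbar ∧ ∀ ε : ℝ, 0 < ε → ε < εbar →
      ∀ K : ℕ, IsLeast {K : ℕ | EnoughEpochs ε₀ η₀ B ε K} K → K ≤ 33 * Real.log (1 / ε) := by
  obtain ⟨K₀, hK₀⟩ := eventually_atTop.1 (eventually_affine_le_exp (δ := 1 / 32) (by norm_num)
    (1200 * ε₀) (6000 * η₀ * B ^ 2))
  refine ⟨Real.exp (-(max 1 ((K₀ : ℝ) / 32))), Real.exp_pos _, fun ε hε hεb K hK => ?_⟩
  set l := Real.log (1 / ε) with hl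
  have hlb : max 1 ((K₀ : ℝ) / 32) ≤ l := by
    rw [hl, one_div, Real.log_inv, le_neg, Real.log_le_iff_le_exp hε]
    exact hεb.le
  have hl1 : 1 ≤ l := (le_max_left _ _).trans hlb
  have hlK : (K₀ : ℝ) / 32 ≤ l := (le_max_right _ _).trans hlb
  -- Split exp(n/16) into two factors exp(n/32): one beats 1/ε, the other beats the terms affine in
  -- n. Since l ≥ 1, rounding up turns 32 into 33.
  set n := ⌈32 * l⌉₊ with hn
  have hn1 : 32 * l ≤ n := Nat.le_ceil _
  have hn2 : (n : ℝ) < 32 * l + 1 := Nat.ceil_lt_add_one (by linarith)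
  have hnK : K₀ ≤ n := by
    have : (K₀ : ℝ) ≤ n := by linarith
    exact_mod_cast this
  have hexp : Real.exp (1 / 32 * n) ≤ ε * Real.exp (n / 16) := by
    have e : Real.exp ((n : ℝ) / 16) = Real.exp (1 / 32 * n) * Real.exp (1 / 32 * n) := by
      rw [← Real.exp_add]; congr 1; ring
    have h1 : 1 / ε ≤ Real.exp (1 / 32 * n) := by
      rw [← Real.log_le_iff_le_exp (by positivity)]; linarith
    rw [div_le_iff₀' hε] at h1
    rw [e, ← mul_assoc]
    exact le_mul_of_one_le_left (Real.exp_pos _).le h1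
  obtain ⟨ha, hb⟩ := hK₀ n hnK
  have hmem : EnoughEpochs ε₀ η₀ B ε n := (enoughEpochs_iff hε₀ hη₀ hB hε n).2
    ⟨by
      have : (1 : ℝ) ≤ n := by linarith
      exact_mod_cast this, by linarith, by linarith⟩
  have : (K : ℝ) ≤ n := by exact_mod_cast hK.2 hmem
  linarith

theorem exists_totalIterations_le_log {μ μy : ℝ} (hμ : 0 < μ) (hμy : 0 < μy) (hε₀ : 0 < ε₀)
    (hη₀ : 0 < η₀) (hB : 0 < B) :
    ∃ εbar : ℝ, 0 < εbar ∧ ∀ ε : ℝ, 0 < ε → ε < εbar →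
      ∃ K : ℕ, IsLeast {K : ℕ | EnoughEpochs ε₀ η₀ B ε K} K ∧
        (totalIterations η₀ μ μy K : ℝ) ≤
          24000000000 * (B ^ 2 / (min μ μy * ε)) * Real.log (1 / ε) := by
  have hm : 0 < min μ μy := lt_min hμ hμy
  obtain ⟨ε₁, hε₁, hlog⟩ := exists_least_enoughEpochs_le_log hε₀ hη₀ hB
  -- The last two thresholds simplify the explicit bound: `B² / min μ μy` lets the summand K be
  -- absorbed, and the exponential one forces K B² to win the maximum.
  refine ⟨min (min ε₀ ε₁) (min (B ^ 2 / min μ μy)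
    (1200 * ε₀ * Real.exp (-(ε₀ / η₀ / B ^ 2 / 16)))), by positivity, fun ε hε hεb => ?_⟩
  obtain ⟨⟨b0, b1⟩, b2, b3⟩ := by simpa only [lt_min_iff] using hεb
  obtain ⟨K, hK⟩ := exists_isLeast_enoughEpochs hε₀ hη₀ hB hε
  refine ⟨K, hK, ?_⟩
  have h1 := totalIterations_least_le hμ hμy hε₀ hη₀ hB hε b0.le hK
  have h2 := hlog ε hε b1 K hK
  have hKmax : max (ε₀ / η₀) (K * B ^ 2) = K * B ^ 2 := by
    refine max_eq_right ?_
    by_contra hcon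
    push Not at hcon
    rw [← lt_div_iff₀ (by positivity)] at hcon
    have h3 := ((enoughEpochs_iff hε₀ hη₀ hB hε K).1 hK.1).2.1
    have h4 : Real.exp ((K : ℝ) / 16) ≤ Real.exp (ε₀ / η₀ / B ^ 2 / 16) := by gcongr
    have h5 := mul_le_mul_of_nonneg_left h4 hε.le
    rw [Real.exp_neg, ← div_eq_mul_inv, lt_div_iff₀ (Real.exp_pos _)] at b3
    linarith
  rw [hKmax] at h1
  set a := B ^ 2 / (min μ μy * ε) with ha
  have ha1 : 1 ≤ a := by
    rw [ha, one_le_div (by positivity)]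
    rw [lt_div_iff₀ hm] at b2
    linarith
  have e : K * B ^ 2 / (min μ μy * ε) = K * a := by rw [ha]; ring
  rw [e] at h1
  have hK0 : (0 : ℝ) ≤ K := by positivity
  have h6 : (K : ℝ) ≤ K * a := le_mul_of_one_le_right hK0 ha1
  have h7 := mul_le_mul_of_nonneg_right h2 (show 0 ≤ a by linarith)
  have h8 : 0 ≤ K * a := by positivity
  linarith

/-- The constants fit because 532/1200 + 2782/6000 < 1. -/
theorem mul_exp_le_of_enoughEpochs (hε₀ : 0 < ε₀) (hη₀ : 0 < η₀) (hB : 0 < B) (hε : 0 < ε) {K : ℕ}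
    (hK : EnoughEpochs ε₀ η₀ B ε K) :
    Real.exp (-(K / 16 : ℝ)) * (532 * ε₀ + K * (2782 * (η₀ * B ^ 2))) ≤ ε := by
  obtain ⟨-, h1, h2⟩ := (enoughEpochs_iff hε₀ hη₀ hB hε K).1 hK
  rw [Real.exp_neg, inv_mul_le_iff₀ (Real.exp_pos _)]
  linarith [mul_pos hε (Real.exp_pos ((K : ℝ) / 16))]

end Complexity

end PES

/-! ### Assembly of the accuracy and complexity claims. -/

theorem mainTheorem8 :
    ∃ C : ℝ, 0 < C ∧
    ∀ (d d' : ℕ)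
      -- the objective, its partial gradients and the feasible set
      (Y : Set (EuclideanSpace ℝ (Fin d')))
      (f : EuclideanSpace ℝ (Fin d) → EuclideanSpace ℝ (Fin d') → ℝ)
      (gx : EuclideanSpace ℝ (Fin d) → EuclideanSpace ℝ (Fin d') → EuclideanSpace ℝ (Fin d))
      (gy : EuclideanSpace ℝ (Fin d) → EuclideanSpace ℝ (Fin d') → EuclideanSpace ℝ (Fin d'))
      -- the stochastic gradient oracle and the samples
      (S : Type*) [MeasurableSpace S] (ν : Measure S) [IsProbabilityMeasure ν]
      (Gx : EuclideanSpace ℝ (Fin d) → EuclideanSpace ℝ (Fin d') → S → EuclideanSpace ℝ (Fin d))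
      (Gy : EuclideanSpace ℝ (Fin d) → EuclideanSpace ℝ (Fin d') → S → EuclideanSpace ℝ (Fin d'))
      (Ω : Type*) [MeasurableSpace Ω] (Pr : Measure Ω) [IsProbabilityMeasure Pr]
      (ξ : ℕ → ℕ → Ω → S)
      -- the parameters, a minimizer of the primal objective, and the starting point
      (ℓ L μ μy ρ B ε₀ η₀ : ℝ)
      (xstar x₀ : EuclideanSpace ℝ (Fin d)) (y₀ : EuclideanSpace ℝ (Fin d')),
      IsClosed Y → Convex ℝ Y → y₀ ∈ Y →
      0 < μ → 0 < μy → 0 < B → 0 < ε₀ →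
      -- smoothness of `f`, strong concavity in `y`, smoothness of `P`, existence of a minimizer
      PES.HasPartialGradients Y f gx gy →
      PES.LipschitzField Y ℓ gx gy →
      (∀ x, StrongConcaveOn Y μy (f x)) →
      PES.LSmooth L (PES.primal Y f) →
      (∀ x, PES.primal Y f xstar ≤ PES.primal Y f x) →
      -- the duality gap at the starting point is finite and at most `ε₀`
      BddBelow (Set.range fun x => f x y₀) → PES.dualityGap Y f x₀ y₀ ≤ ε₀ →
      -- PL condition for `P` and weak convexity in `x`, with `ρ ≤ μ / 8`
      PES.PLCondition μ (PES.primal Y f) xstar →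
      0 < ρ → ρ ≤ ℓ → ρ ≤ μ / 8 →
      (∀ y ∈ Y, PES.WeaklyConvex ρ (fun x => f x y) (fun x => gx x y)) →
      -- unbiased stochastic gradients, independent samples
      Measurable (fun p : EuclideanSpace ℝ (Fin d) × EuclideanSpace ℝ (Fin d') × S =>
        Gx p.1 p.2.1 p.2.2) →
      Measurable (fun p : EuclideanSpace ℝ (Fin d) × EuclideanSpace ℝ (Fin d') × S =>
        Gy p.1 p.2.1 p.2.2) →
      (∀ x, ∀ y ∈ Y, Integrable (Gx x y) ν ∧ ∫ s, Gx x y s ∂ν = gx x y) →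
      (∀ x, ∀ y ∈ Y, Integrable (Gy x y) ν ∧ ∫ s, Gy x y s ∂ν = gy x y) →
      (∀ k t, Measurable (ξ k t)) → (∀ k t, Pr.map (ξ k t) = ν) →
      iIndepFun (fun i : ℕ × ℕ => ξ i.1 i.2) Pr →
      -- step size
      0 < η₀ → η₀ ≤ 1 / ρ →
      -- the second moments of the stochastic gradients at the iterates are bounded by `B ^ 2`
      (∀ k, ∀ t ≤ PES.epochLength η₀ μ μy (k + 1), ∀ᵐ ω ∂Pr,
        let z := PES.pesInner Y Gx Gy (μ / 4) (PES.stepSize η₀) (PES.epochLength η₀ μ μy)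
          (x₀, y₀) (fun i j => ξ i j ω) k t
        (Integrable (fun s => ‖Gx z.1 z.2 s‖ ^ 2) ν ∧ ∫ s, ‖Gx z.1 z.2 s‖ ^ 2 ∂ν ≤ B ^ 2) ∧
        (Integrable (fun s => ‖Gy z.1 z.2 s‖ ^ 2) ν ∧ ∫ s, ‖Gy z.1 z.2 s‖ ^ 2 ∂ν ≤ B ^ 2)) →
      -- accuracy after sufficiently many epochs
      (∀ ε : ℝ, 0 < ε → ∀ K : ℕ, PES.EnoughEpochs ε₀ η₀ B ε K →
        let Δ : Ω → ℝ := fun ω => PES.lyapunov Y f (μ / 4) xstar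
          (PES.pes Y Gx Gy (μ / 4) (PES.stepSize η₀) (PES.epochLength η₀ μ μy)
            (x₀, y₀) (fun i j => ξ i j ω) K)
        Integrable Δ Pr ∧ ∫ ω, Δ ω ∂Pr ≤ ε) ∧
      -- total iteration complexity: an explicit bound, and the rate as `ε → 0`
      (∀ ε : ℝ, 0 < ε → ε ≤ ε₀ →
        ∃ K : ℕ, IsLeast {K : ℕ | PES.EnoughEpochs ε₀ η₀ B ε K} K ∧
          (PES.totalIterations η₀ μ μy K : ℝ)
            ≤ C * (max (ε₀ / η₀) (K * B ^ 2) / (min μ μy * ε)) + K) ∧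
      (∃ εbar : ℝ, 0 < εbar ∧ ∀ ε : ℝ, 0 < ε → ε < εbar →
        ∃ K : ℕ, IsLeast {K : ℕ | PES.EnoughEpochs ε₀ η₀ B ε K} K ∧
          (PES.totalIterations η₀ μ μy K : ℝ)
            ≤ C * (B ^ 2 / (min μ μy * ε)) * Real.log (1 / ε)) := by
  -- Dictated by the logarithmic bound, which needs 33 · (7 · 10⁸ + 1); the explicit bound needs
  -- only 7 · 10⁸.
  refine ⟨24000000000, by norm_num, ?_⟩
  intro d d' Y f gx gy S _ ν _ Gx Gy Ω _ Pr _ ξ ℓ L μ μy ρ B ε₀ η₀ xstar x₀ y₀ hcl hconv hy₀ hμ hμy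
    hB hε₀ hgrad _ hsc hsmooth hmin hbdd hgap hpl _ _ hρ hwc hGx hGy hux huy hξ hν hind hη₀ _ hmom
  have h : PES.SaddleProblem Y f gx gy μ μy ρ xstar :=
    ⟨⟨y₀, hy₀⟩, hcl, hconv, hμ, hμy, hρ, hgrad, hsc, hsmooth.1, hmin, hpl, hwc⟩
  have ho : PES.UnbiasedOracle Y gx gy ν Gx Gy := ⟨hGx, hGy, hux, huy⟩
  have hD : PES.lyapunov Y f (μ / 4) xstar (x₀, y₀) ≤ 532 * ε₀ := by
    linarith [h.lyapunov_start_le (x₀ := x₀) hy₀ hbdd]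
  refine ⟨fun ε hε K hK => ?_, fun ε hε hεε => ?_, ?_⟩
  · obtain ⟨-, hi, hb⟩ := h.integral_lyapunov_pes_le ho hη₀ (x₀, y₀) hy₀ hD hξ hν hind hmom K
    exact ⟨hi, hb.trans (PES.mul_exp_le_of_enoughEpochs hε₀ hη₀ hB hε hK)⟩
  · obtain ⟨K, hK⟩ := PES.exists_isLeast_enoughEpochs hε₀ hη₀ hB hε
    refine ⟨K, hK, (PES.totalIterations_least_le hμ hμy hε₀ hη₀ hB hε hεε hK).trans ?_⟩
    have hm : 0 < min μ μy := lt_min hμ hμy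
    gcongr
    norm_num
  · exact PES.exists_totalIterations_le_log hμ hμy hε₀ hη₀ hB
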